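/- Let $A\in\mathbb{R}^{m\times n}$ with $\operatorname{rk}(A)=m$, $b\in\mathbb{R}^m$, $N\subseteq[n]$, and let $c\in\{0,1\}^n$ be the indicator vector of $N$. Consider the linear program $$\min\ \langle c,x\rangle\quad\text{s.t.}\quad x\in P:=\{x\in\mathbb{R}^n: Ax=b,\ x\ge 0\},$$ and let an initial point $x^{(0)}\in P$ be given. An elementary vector of $A$ is a nonzero vector of $\ker A$ whose support is inclusion-minimal among the supports of nonzero vectors of $\ker A$. The circuit imbalance $\kappa_A$ is the maximum of $|g_i/g_j|$ over all elementary vectors $g$ and all $i,j\in\operatorname{supp}(g)$ (with $\kappa_A=1$ if $\ker A=\{0\}$). Two subroutines are available. * Ratio-Circuit$(A,c,w)$, for weights $w\in(\mathbb{R}_{\ge 0}\cup\{\infty\})^n$ (with $\infty\cdot 0=0$): whenever the problem is bounded, it returns an optimal solution $z$ of $\min\{\langle c,z\rangle: Az=0,\ \sum_i w_i\max\{0,-z_i\}\le 1\}$ that is an elementary vector or $0$, as every basic optimal solution is, and an optimal solution $(y,s,\lambda)$ of the dual $\max\{-\lambda: s=c-A^\top y,\ \lambda\ge0,\ 0\le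 s_i \text{ for all } i,\ s_i\le\lambda w_i \text{ whenever } w_i<\infty\}$. * Support-Circuit$(A,c,x,S)$ returns an elementary vector $z$ with $\operatorname{supp}(z)\subseteq\operatorname{supp}(x)$, $\operatorname{supp}(z)\cap S\ne\emptyset$ and $\langle c,z\rangle\le 0$, or reports that there is none. A circuit augmentation algorithm starts at $x^{(0)}$ and, as long as $x^{(t)}_N\neq 0$, chooses, depending on its input, on the current iterate and on its memory, one of two calls. It either calls Ratio-Circuit$(A,c,w)$ with the weights $w_i=1/x^{(t)}_i$ (where $1/0=\infty$), stopping with the returned dual vector $y$ if $\langle b,y\rangle>0$, or it calls Support-Circuit$(A,c,x^{(t)},N)$. If it has not stopped, it sets $x^{(t+1)}=x^{(t)}+\alpha z$, where $z$ is the returned vector and $\alpha$ is the largest step size with $x^{(t)}+\alpha z\in P$. There are an absolute constant $C$ and a circuit augmentation algorithm such that, for all $m,n,A,b,N,x^{(0)}$ as above and all correct subroutines, the algorithm stops, and it returns either some $x\in P$ with $x_N=0$, or a vector $y$ with $A^\top y\le c$ and $\langle b,y\rangle>0$, a dual certificate that no $x\in P$ with $x_N=0$ exists. Each of its steps, except a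 last one that returns a dual certificate, is a maximal augmentation with step size $\alpha>0$ along an elementary vector $z$ with $\langle c,z\rangle\le 0$. It makes at most $C\,mn\log(n+\kappa_A)$ calls to Ratio-Circuit and at most $(m+1)n$ calls to Support-Circuit. -/

import Mathlib

open scoped Matrix ENNReal

namespace CircuitAug

variable {m n : ℕ}

/-- The polyhedron `{x : A x = b, x ≥ 0}`. -/
def feasible (A : Matrix (Fin m) (Fin n) ℝ) (b : Fin m → ℝ) : Set (Fin n → ℝ) :=
  {x | A *ᵥ x = b ∧ ∀ i, 0 ≤ x i}

/-- The cost vector that is `1` on `N` and `0` off `N`. -/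
def cost (N : Finset (Fin n)) : Fin n → ℝ := fun i => if i ∈ N then 1 else 0

/-- `g` is an elementary vector of `ker A`: a nonzero vector of the kernel with
inclusion-minimal support. -/
def IsElementary (A : Matrix (Fin m) (Fin n) ℝ) (g : Fin n → ℝ) : Prop :=
  g ≠ 0 ∧ A *ᵥ g = 0 ∧
    ∀ h : Fin n → ℝ, h ≠ 0 → A *ᵥ h = 0 → ¬ Function.support h ⊂ Function.support g

/-- The circuit imbalance measure of `A`: the largest ratio `|g i| / |g j|` over the elementary
vectors `g` and `i, j` in the support of `g`. Inserting `1` changes nothing if there is an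
elementary vector (take `i = j`), and gives the usual value `1` if `ker A = 0`. -/
noncomputable def kappa (A : Matrix (Fin m) (Fin n) ℝ) : ℝ :=
  sSup (insert 1 {r | ∃ g i j, IsElementary A g ∧ g i ≠ 0 ∧ g j ≠ 0 ∧ r = |g i| / |g j|})

/-! ### The minimum-ratio subroutine -/

/-- Feasible solutions of `A z = 0, ⟨w, z⁻⟩ ≤ 1`, where weights may be infinite and `∞ * 0 = 0`. -/
def ratioFeasible (A : Matrix (Fin m) (Fin n) ℝ) (w : Fin n → ℝ≥0∞) : Set (Fin n → ℝ) :=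
  {z | A *ᵥ z = 0 ∧ ∑ i, w i * ENNReal.ofReal (max 0 (-z i)) ≤ 1}

/-- What the minimum-ratio subroutine returns: a primal solution `z` and a dual solution
`(y, s)` together with its value `lam`. -/
structure RatioReply (m n : ℕ) where
  z : Fin n → ℝ
  y : Fin m → ℝ
  s : Fin n → ℝ
  lam : ℝ

/-- Feasibility in the dual program `max -lam` subject to `s = c - Aᵀ y`, `0 ≤ s ≤ lam w`,
`lam ≥ 0`. An infinite weight imposes no upper bound on `s`. -/
def RatioDualFeasible (A : Matrix (Fin m) (Fin n) ℝ) (c : Fin n → ℝ) (w : Fin n → ℝ≥0∞)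
    (y : Fin m → ℝ) (s : Fin n → ℝ) (lam : ℝ) : Prop :=
  0 ≤ lam ∧ s = c - Aᵀ *ᵥ y ∧ ∀ i, 0 ≤ s i ∧ (w i ≠ ∞ → s i ≤ lam * (w i).toReal)

/-- `r` is a correct reply on input `(A, c, w)`: `r.z` minimizes `⟨c, z⟩` subject to `A z = 0`,
`⟨w, z⁻⟩ ≤ 1`, and is zero or an elementary vector, which every basic solution is;
`(r.y, r.s, r.lam)` is optimal for the dual. -/
structure IsRatioReply (A : Matrix (Fin m) (Fin n) ℝ) (c : Fin n → ℝ) (w : Fin n → ℝ≥0∞)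
    (r : RatioReply m n) : Prop where
  primal_feasible : r.z ∈ ratioFeasible A w
  primal_optimal : ∀ z ∈ ratioFeasible A w, c ⬝ᵥ r.z ≤ c ⬝ᵥ z
  primal_basic : r.z = 0 ∨ IsElementary A r.z
  dual_feasible : RatioDualFeasible A c w r.y r.s r.lam
  dual_optimal : ∀ y s lam, RatioDualFeasible A c w y s lam → -lam ≤ -r.lam

/-- `R` implements the minimum-ratio subroutine: its reply is correct on each input on which the
(always feasible) program is bounded. Nothing is promised on unbounded inputs. -/
def IsRatioCircuit
    (R : Matrix (Fin m) (Fin n) ℝ → (Fin n → ℝ) → (Fin n → ℝ≥0∞) → RatioReply m n) : Prop :=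
  ∀ A c w, BddBelow ((fun z => c ⬝ᵥ z) '' ratioFeasible A w) → IsRatioReply A c w (R A c w)

/-- The weights `1 / x`, with `1 / 0 = ∞`. -/
noncomputable def wallacherWeights (x : Fin n → ℝ) : Fin n → ℝ≥0∞ :=
  fun i => (ENNReal.ofReal (x i))⁻¹

/-! ### The support-circuit subroutine -/

/-- `z` is an elementary vector with support inside that of `x` that meets `S`, and `⟨c, z⟩ ≤ 0`. -/
def IsSupportReply (A : Matrix (Fin m) (Fin n) ℝ) (c x : Fin n → ℝ) (S : Finset (Fin n))
    (z : Fin n → ℝ) : Prop :=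
  IsElementary A z ∧ Function.support z ⊆ Function.support x ∧ (∃ i ∈ S, z i ≠ 0) ∧ c ⬝ᵥ z ≤ 0

/-- `Q` implements the support-circuit subroutine: it returns such a vector, or concludes
(by the value `none`) that there is none. -/
def IsSupportCircuit
    (Q : Matrix (Fin m) (Fin n) ℝ → (Fin n → ℝ) → (Fin n → ℝ) → Finset (Fin n) →
      Option (Fin n → ℝ)) : Prop :=
  ∀ A c x S, (∀ z, Q A c x S = some z → IsSupportReply A c x S z) ∧
    (Q A c x S = none → ∀ z, ¬ IsSupportReply A c x S z)

/-! ### Augmentation steps and algorithms -/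

/-- `x + α g` for the largest `α` for which it is in the polyhedron. -/
noncomputable def aug (A : Matrix (Fin m) (Fin n) ℝ) (b : Fin m → ℝ) (x g : Fin n → ℝ) :
    Fin n → ℝ :=
  x + sSup {a : ℝ | x + a • g ∈ feasible A b} • g

/-- `x'` arises from `x` by a genuine maximal circuit augmentation: `x' = x + α g` with `g` an
elementary vector, `⟨c, g⟩ ≤ 0`, and `α > 0` the largest (and existing) feasible step size. -/
def IsMaxAugmentation (A : Matrix (Fin m) (Fin n) ℝ) (b : Fin m → ℝ) (c x x' : Fin n → ℝ) :
    Prop :=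
  ∃ g, IsElementary A g ∧ c ⬝ᵥ g ≤ 0 ∧
    ∃ α : ℝ, 0 < α ∧ IsGreatest {a : ℝ | x + a • g ∈ feasible A b} α ∧ x' = x + α • g

/-- The two kinds of steps. -/
inductive StepKind
  | ratio
  | support

/-- The control part of a circuit augmentation algorithm: it keeps a memory, and from the memory
and the current iterate it decides which subroutine to call next. It cannot change the iterate
or produce an output in any other way. -/
structure Algorithm (n : ℕ) where
  Mem : Type
  init : Mem
  next : Mem → (Fin n → ℝ) → StepKind × Mem

/-- A configuration of a run: current iterate, memory, numbers of calls made so far to the two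
subroutines, and the dual vector that the run has stopped with, if any. -/
structure Config (m : ℕ) {n : ℕ} (alg : Algorithm n) where
  x : Fin n → ℝ
  mem : alg.Mem
  ratioCalls : ℕ
  supportCalls : ℕ
  dual : Option (Fin m → ℝ)

/-- The run has stopped: it returns the iterate `x`, which vanishes on `N`, or a dual vector. -/
def Config.Stopped {alg : Algorithm n} (N : Finset (Fin n)) (s : Config m alg) : Prop :=
  (∀ i ∈ N, s.x i = 0) ∨ s.dual ≠ none

open scoped Classical in
/-- One step of a run. Unless the run has stopped, the algorithm picks one of two calls.
* Ratio: call `R` on `(A, c, 1 / x)`. If the dual vector `y` of the reply has `⟨b, y⟩ > 0`, stop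
  with `y`; otherwise augment `x` maximally along the primal vector of the reply.
* Support: call `Q` on `(A, c, x, N)` and augment `x` maximally along the reply, if there is one. -/
noncomputable def step
    (R : Matrix (Fin m) (Fin n) ℝ → (Fin n → ℝ) → (Fin n → ℝ≥0∞) → RatioReply m n)
    (Q : Matrix (Fin m) (Fin n) ℝ → (Fin n → ℝ) → (Fin n → ℝ) → Finset (Fin n) →
      Option (Fin n → ℝ))
    (A : Matrix (Fin m) (Fin n) ℝ) (b : Fin m → ℝ) (N : Finset (Fin n)) (alg : Algorithm n)
    (s : Config m alg) : Config m alg :=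
  if s.Stopped N then s
  else
    match alg.next s.mem s.x with
    | (StepKind.ratio, mem') =>
      let r := R A (cost N) (wallacherWeights s.x)
      if 0 < b ⬝ᵥ r.y then
        { s with mem := mem', ratioCalls := s.ratioCalls + 1, dual := some r.y }
      else
        { s with x := aug A b s.x r.z, mem := mem', ratioCalls := s.ratioCalls + 1 }
    | (StepKind.support, mem') =>
      match Q A (cost N) s.x N with
      | some z =>
        { s with x := aug A b s.x z, mem := mem', supportCalls := s.supportCalls + 1 }
      | none =>
        { s with mem := mem', supportCalls := s.supportCalls + 1 }

/-- The configuration after `t` steps from the initial point `x₀`. -/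
noncomputable def run
    (R : Matrix (Fin m) (Fin n) ℝ → (Fin n → ℝ) → (Fin n → ℝ≥0∞) → RatioReply m n)
    (Q : Matrix (Fin m) (Fin n) ℝ → (Fin n → ℝ) → (Fin n → ℝ) → Finset (Fin n) →
      Option (Fin n → ℝ))
    (A : Matrix (Fin m) (Fin n) ℝ) (b : Fin m → ℝ) (N : Finset (Fin n)) (alg : Algorithm n)
    (x₀ : Fin n → ℝ) (t : ℕ) : Config m alg :=
  (step R Q A b N alg)^[t]
    { x := x₀, mem := alg.init, ratioCalls := 0, supportCalls := 0, dual := none }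

/-- `y` is a dual solution of positive value for the program `min ⟨c, x⟩, A x = b, x ≥ 0` with `c`
the indicator of `N`. By weak duality it certifies that no feasible `x` vanishes on `N`. -/
def IsDualCertificate (A : Matrix (Fin m) (Fin n) ℝ) (b : Fin m → ℝ) (N : Finset (Fin n))
    (y : Fin m → ℝ) : Prop :=
  (∀ i, (Aᵀ *ᵥ y) i ≤ cost N i) ∧ 0 < b ⬝ᵥ y

end CircuitAug

/-! Write X for the current cost ⟨c, x⟩. Unless a minimum-ratio call yields a dual certificate, LP
duality makes it shrink X by a factor 1 - 1/n (`ratioReply_improves`). That alone gives only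
geometric convergence; finiteness comes from a rank argument. Every augmentation decreases some
coordinate of N, which is at most X, so by the definition of κ no coordinate falls by more than κX
(`IsElementary.sub_kappa_mul_le_step`). A coordinate that is a sufficiently large multiple of κX
therefore stays large: ratio steps shrink X itself, and support steps are few.

The algorithm collects a set L of large coordinates outside N with linearly independent columns, so
|L| ≤ m. After each addition to L it makes support calls until no support circuit is left; each
removes an element of supp x, which costs at most n calls per member of L and n at the start. Let x₁
be the point reached and let ratio steps then lower X by a factor 6n⁴κ². Some coordinate of N has
lost at least half its value, and one elementary vector g conformal to the displacement carries a
1/n share of that loss. If L spanned the columns of all coordinates of supp g that vanish at x₁,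
these could be exchanged for L ⊆ supp x₁, producing a support circuit at x₁. So g raises some j with
x₁_j = 0 and column outside the span of L, and bounded imbalance makes x_j large compared with the
new X: j can join L (`exists_addable`). Hence there are at most m + 1 phases of O(n log(n + κ))
ratio calls each. The bookkeeping is carried by `Invariant`. -/

namespace CircuitAug

variable {m n : ℕ}

/-! ### Elementary vectors and conformal decompositions -/

theorem IsElementary.smul {A : Matrix (Fin m) (Fin n) ℝ} {g : Fin n → ℝ} (hg : IsElementary A g)
    {t : ℝ} (ht : t ≠ 0) : IsElementary A (t • g) := by
  refine ⟨smul_ne_zero ht hg.1, by rw [Matrix.mulVec_smul, hg.2.1, smul_zero], ?_⟩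
  rw [Function.support_const_smul_of_ne_zero t g ht]
  exact hg.2.2

theorem IsElementary.neg {A : Matrix (Fin m) (Fin n) ℝ} {g : Fin n → ℝ} (hg : IsElementary A g) :
    IsElementary A (-g) := by
  simpa using hg.smul (t := -1) (by norm_num)

/-- Moving from `d` along `-h` until the first sign condition becomes tight. -/
theorem exists_tight_step {d h : Fin n → ℝ} (hd : ∃ j, 0 < h j * d j) :
    ∃ t : ℝ, 0 < t ∧ (∀ j, 0 ≤ (d j - t * h j) * d j) ∧ ∃ k, d k ≠ 0 ∧ d k = t * h k := by
  obtain ⟨j₀, hj₀⟩ := hd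
  obtain ⟨k, hk, hmin⟩ := Finset.exists_min_image
    (Finset.univ.filter fun j => 0 < h j * d j) (fun j => d j / h j) ⟨j₀, by simpa using hj₀⟩
  simp only [Finset.mem_filter, Finset.mem_univ, true_and] at hk hmin
  have hhk : h k ≠ 0 := fun h0 => by simp [h0] at hk
  have hdk : d k ≠ 0 := fun h0 => by simp [h0] at hk
  have ht : 0 < d k / h k := by
    have : d k / h k = h k * d k / (h k) ^ 2 := by field_simp
    rw [this]; positivity
  refine ⟨d k / h k, ht, fun j => ?_, k, hdk, by field_simp⟩
  rcases le_or_gt (h j * d j) 0 with hj | hj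
  · nlinarith [sq_nonneg (d j), mul_nonneg ht.le (neg_nonneg.2 hj)]
  · have h1 := hmin j hj
    have hhj : h j ≠ 0 := fun h0 => by simp [h0] at hj
    have h2 : d j / h j * (h j * d j) = d j ^ 2 := by field_simp
    nlinarith [mul_le_mul_of_nonneg_right h1 hj.le]

theorem support_sub_smul_ssubset {d h : Fin n → ℝ} {t : ℝ}
    (hs : Function.support h ⊆ Function.support d) {k : Fin n} (hk : d k ≠ 0)
    (hkt : d k = t * h k) : Function.support (d - t • h) ⊂ Function.support d := by
  refine (Set.ssubset_iff_of_subset fun j hj => ?_).2 ⟨k, hk, by simp [hkt]⟩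
  by_contra hdj
  have h0 : d j = 0 := by simpa using hdj
  have h1 : h j = 0 := by
    by_contra hne
    exact hdj (hs hne)
  simp [h0, h1] at hj

/-- Induction on the support: if d is not elementary, a kernel vector h of smaller support, signed
to agree with d somewhere, is subtracted until a coordinate of d vanishes. No sign is reversed, and
the difference is nonzero because it equals d off supp h. -/
theorem exists_elementary_sign_conformal (A : Matrix (Fin m) (Fin n) ℝ) (d : Fin n → ℝ)
    (hd : d ≠ 0) (hA : A *ᵥ d = 0) :
    ∃ g, IsElementary A g ∧ Function.support g ⊆ Function.support d ∧ ∀ j, 0 ≤ g j * d j := by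
  induction hk : (Function.support d).ncard using Nat.strong_induction_on generalizing d with
  | _ k ih =>
    by_cases hel : IsElementary A d
    · exact ⟨d, hel, subset_rfl, fun j => mul_self_nonneg _⟩
    · have : ∃ h : Fin n → ℝ, h ≠ 0 ∧ A *ᵥ h = 0 ∧ Function.support h ⊂ Function.support d := by
        by_contra hcon
        push Not at hcon
        exact hel ⟨hd, hA, hcon⟩
      obtain ⟨h, hh, hAh, hss⟩ := this
      have key : ∃ h : Fin n → ℝ, A *ᵥ h = 0 ∧ Function.support h ⊂ Function.support d ∧
          ∃ j, 0 < h j * d j := by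
        obtain ⟨j, hj⟩ := Function.ne_iff.1 hh
        have hdj : d j ≠ 0 := hss.1 hj
        rcases lt_or_gt_of_ne (mul_ne_zero hj hdj) with hlt | hgt
        · exact ⟨-h, by rw [Matrix.mulVec_neg, hAh, neg_zero], by rwa [Function.support_neg], j,
            by simpa using hlt⟩
        · exact ⟨h, hAh, hss, j, hgt⟩
      obtain ⟨h, hAh, hss, hj⟩ := key
      obtain ⟨t, ht, hsign, k', hk', hkt⟩ := exists_tight_step hj
      have hlt := support_sub_smul_ssubset hss.1 hk' hkt
      obtain ⟨l, hl, hl'⟩ := Set.exists_of_ssubset hss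
      have hne : d - t • h ≠ 0 := by
        intro h0
        have := congrFun h0 l
        have hl0 : h l = 0 := by simpa using hl'
        simp [hl0] at this
        exact hl this
      obtain ⟨g, hg, hgs, hgsign⟩ := ih _ (hk ▸ Set.ncard_lt_ncard hlt (Set.toFinite _)) (d - t • h)
        hne (by rw [Matrix.mulVec_sub, Matrix.mulVec_smul, hA, hAh]; simp) rfl
      refine ⟨g, hg, hgs.trans hlt.1, fun j => ?_⟩
      have h1 := hgsign j
      have h2 := hsign j
      simp only [Pi.sub_apply, Pi.smul_apply, smul_eq_mul] at h1
      by_cases hgj : g j = 0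
      · simp [hgj]
      · have h3 : d j - t * h j ≠ 0 := hgs hgj
        by_contra hneg
        push Not at hneg
        have h4 : 0 < (d j - t * h j) ^ 2 := by positivity
        have h5 : 0 ≤ (g j * (d j - t * h j)) * ((d j - t * h j) * d j) := mul_nonneg h1 h2
        nlinarith

/-- One step of the conformal decomposition: an elementary vector between `0` and `d` can be
subtracted from `d` so that the support shrinks. -/
theorem exists_elementary_conformal (A : Matrix (Fin m) (Fin n) ℝ) (d : Fin n → ℝ)
    (hd : d ≠ 0) (hA : A *ᵥ d = 0) :
    ∃ g, IsElementary A g ∧ (∀ j, g j ∈ Set.uIcc 0 (d j)) ∧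
      Function.support (d - g) ⊂ Function.support d := by
  obtain ⟨g, hg, hgs, hsign⟩ := exists_elementary_sign_conformal A d hd hA
  obtain ⟨j, hj⟩ := Function.ne_iff.1 hg.1
  obtain ⟨t, ht, hsg, k, hk, hkt⟩ := exists_tight_step (d := d) (h := g)
    ⟨j, lt_of_le_of_ne (hsign j) (mul_ne_zero hj (hgs hj)).symm⟩
  refine ⟨t • g, hg.smul ht.ne', fun j => ?_, support_sub_smul_ssubset hgs hk hkt⟩
  have h1 := hsign j
  have h2 := hsg j
  simp only [Pi.smul_apply, smul_eq_mul]
  rw [Set.mem_uIcc]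
  rcases lt_trichotomy (d j) 0 with hdj | hdj | hdj
  · right
    constructor <;> nlinarith
  · have : g j = 0 := by
      by_contra hne
      exact hgs hne hdj
    simp [this, hdj]
  · left
    constructor <;> nlinarith

/-- A conformal decomposition of d has at most k terms, so by pigeonhole one of them carries a 1/k
share of entry i. A term with a smaller share is peeled off; this shrinks the support and leaves
more than a k/(k+1) share when the bound was k + 1. -/
theorem exists_elementary_large (A : Matrix (Fin m) (Fin n) ℝ) (i : Fin n) (k : ℕ)
    (d : Fin n → ℝ) (hA : A *ᵥ d = 0) (hi : d i ≠ 0) (hk : (Function.support d).ncard ≤ k) :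
    ∃ g, IsElementary A g ∧ (∀ j, g j ∈ Set.uIcc 0 (d j)) ∧ |d i| ≤ k * |g i| := by
  induction k generalizing d with
  | zero =>
    have : Function.support d = ∅ := (Set.ncard_eq_zero (Set.toFinite _)).1 (Nat.le_zero.1 hk)
    have h1 : i ∈ Function.support d := hi
    simp [this] at h1
  | succ k ih =>
    have hd : d ≠ 0 := fun h => hi (by simp [h])
    obtain ⟨g, hg, hgc, hss⟩ := exists_elementary_conformal A d hd hA
    by_cases hbig : |d i| ≤ ((k + 1 : ℕ) : ℝ) * |g i|
    · exact ⟨g, hg, hgc, hbig⟩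
    · push_cast at hbig ⊢
      push Not at hbig
      have htri : |d i| ≤ |(d - g) i| + |g i| := by
        have := abs_add_le ((d - g) i) (g i)
        simpa using this
      have hi' : (d - g) i ≠ 0 := by
        intro h0
        rw [h0] at htri
        simp only [abs_zero, zero_add] at htri
        nlinarith [abs_nonneg (g i), (Nat.cast_nonneg k : (0 : ℝ) ≤ k)]
      obtain ⟨g', hg', hgc', hle⟩ := ih (d - g)
        (by rw [Matrix.mulVec_sub, hA, hg.2.1, sub_zero]) hi'
        (by have := Set.ncard_lt_ncard hss (Set.toFinite _); omega)
      refine ⟨g', hg', fun j => ?_, ?_⟩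
      · refine Set.uIcc_subset_uIcc Set.left_mem_uIcc ?_ (hgc' j)
        have := hgc j
        simp only [Set.mem_uIcc, Pi.sub_apply] at this ⊢
        rcases this with h | h
        · left; constructor <;> linarith
        · right; constructor <;> linarith
      · have hk0 : (0 : ℝ) < k := by
          rcases Nat.eq_zero_or_pos k with h0 | h0
          · subst h0
            have := abs_pos.2 hi'
            simp only [Nat.cast_zero, zero_mul] at hle
            linarith
          · exact_mod_cast h0
        refine le_of_mul_le_mul_left ?_ hk0
        nlinarith

theorem ncard_support_le (d : Fin n → ℝ) : (Function.support d).ncard ≤ n := by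
  simpa using Set.ncard_le_card (Function.support d)

/-! ### The circuit imbalance measure -/

theorem IsElementary.proportional {A : Matrix (Fin m) (Fin n) ℝ} {g h : Fin n → ℝ}
    (hg : IsElementary A g) (hh : IsElementary A h)
    (hs : Function.support g = Function.support h) : ∃ t : ℝ, t ≠ 0 ∧ g = t • h := by
  obtain ⟨k, hk⟩ := Function.ne_iff.1 hh.1
  have hgk : g k ≠ 0 := by
    have : k ∈ Function.support h := hk
    rwa [← hs] at this
  have hkt : g k = g k / h k * h k := (div_mul_cancel₀ _ hk).symm
  have hss := support_sub_smul_ssubset (t := g k / h k) hs.ge hgk hkt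
  refine ⟨g k / h k, div_ne_zero hgk hk, ?_⟩
  by_contra hne
  exact hg.2.2 _ (sub_ne_zero.2 hne)
    (by rw [Matrix.mulVec_sub, Matrix.mulVec_smul, hg.2.1, hh.2.1]; simp) hss

/-- Elementary vectors with equal supports are proportional, so each triple of a support and two
indices contributes at most one ratio. Hence the supremum defining `kappa` is over a bounded set. -/
theorem finite_imbalances (A : Matrix (Fin m) (Fin n) ℝ) :
    {r : ℝ | ∃ g i j, IsElementary A g ∧ g i ≠ 0 ∧ g j ≠ 0 ∧ r = |g i| / |g j|}.Finite := by
  have hsub : {r : ℝ | ∃ g i j, IsElementary A g ∧ g i ≠ 0 ∧ g j ≠ 0 ∧ r = |g i| / |g j|} ⊆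
      ⋃ q : Set (Fin n) × Fin n × Fin n, {r : ℝ | ∃ g, IsElementary A g ∧
        Function.support g = q.1 ∧ r = |g q.2.1| / |g q.2.2|} := by
    rintro r ⟨g, i, j, hg, -, -, hr⟩
    exact Set.mem_iUnion.2 ⟨(Function.support g, i, j), g, hg, rfl, hr⟩
  refine (Set.finite_iUnion fun q => Set.Subsingleton.finite ?_).subset hsub
  rintro r ⟨g, hg, hgs, rfl⟩ r' ⟨h, hh, hhs, rfl⟩
  obtain ⟨t, ht, rfl⟩ := hg.proportional hh (hgs.trans hhs.symm)
  simp only [Pi.smul_apply, smul_eq_mul, abs_mul]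
  exact mul_div_mul_left _ _ (abs_ne_zero.2 ht)

theorem bddAbove_imbalances (A : Matrix (Fin m) (Fin n) ℝ) :
    BddAbove (insert (1 : ℝ)
      {r | ∃ g i j, IsElementary A g ∧ g i ≠ 0 ∧ g j ≠ 0 ∧ r = |g i| / |g j|}) :=
  ((finite_imbalances A).insert 1).bddAbove

theorem one_le_kappa (A : Matrix (Fin m) (Fin n) ℝ) : 1 ≤ kappa A :=
  le_csSup (bddAbove_imbalances A) (Set.mem_insert _ _)

theorem IsElementary.abs_le_kappa_mul {A : Matrix (Fin m) (Fin n) ℝ} {g : Fin n → ℝ}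
    (hg : IsElementary A g) (i : Fin n) {j : Fin n} (hj : g j ≠ 0) :
    |g i| ≤ kappa A * |g j| := by
  by_cases hi : g i = 0
  · rw [hi, abs_zero]
    exact mul_nonneg (zero_le_one.trans (one_le_kappa A)) (abs_nonneg _)
  · rw [← div_le_iff₀ (abs_pos.2 hj)]
    exact le_csSup (bddAbove_imbalances A) (Set.mem_insert_of_mem _ ⟨g, i, j, hg, hi, hj, rfl⟩)

/-! ### Duality for the minimum-ratio program -/

open scoped Pointwise in
/-- Linear programming duality with a box constraint on the slack. -/
theorem exists_boxed_slack (A : Matrix (Fin m) (Fin n) ℝ) (c u : Fin n → ℝ) (hu : ∀ i, 0 ≤ u i)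
    (h : ∀ z, A *ᵥ z = 0 → 0 ≤ c ⬝ᵥ z + ∑ i, u i * max 0 (-z i)) :
    ∃ y : Fin m → ℝ, ∀ i, 0 ≤ (c - Aᵀ *ᵥ y) i ∧ (c - Aᵀ *ᵥ y) i ≤ u i := by
  let W : Submodule ℝ (Fin n → ℝ) := LinearMap.range (Aᵀ.mulVecLin)
  by_cases hc : c ∈ Set.Icc 0 u + (W : Set (Fin n → ℝ))
  · obtain ⟨s, hs, _, ⟨y, rfl⟩, hsum⟩ := Set.mem_add.1 hc
    refine ⟨y, fun i => ?_⟩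
    have : c - Aᵀ *ᵥ y = s := by
      rw [← hsum]; simp [Matrix.mulVec_transpose]
    rw [this]
    exact ⟨hs.1 i, hs.2 i⟩
  · exfalso
    -- The dual is feasible iff c lies in the closed convex set [0, u] + range Aᵀ. Otherwise a
    -- separating functional z is bounded below on the range, so it vanishes there and Az = 0.
    obtain ⟨f, a, hfc, hfa⟩ := geometric_hahn_banach_point_closed
      ((convex_Icc (0 : Fin n → ℝ) u).add W.convex)
      (IsClosed.add_left_of_isCompact (W.closed_of_finiteDimensional) isCompact_Icc) hc
    let z : Fin n → ℝ := fun i => f (Pi.single i 1)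
    have hf : ∀ v, f v = v ⬝ᵥ z := by
      intro v
      conv_lhs => rw [pi_eq_sum_univ' v]
      simp [dotProduct, z, Pi.single]
    have hW : ∀ y : Fin m → ℝ, f (Aᵀ *ᵥ y) = 0 := by
      intro y
      by_contra hne
      have h1 := hfa (0 + Aᵀ *ᵥ (((a - 1) / f (Aᵀ *ᵥ y)) • y))
        (Set.add_mem_add (Set.left_mem_Icc.2 hu) ⟨_, rfl⟩)
      rw [zero_add, Matrix.mulVec_smul, map_smul, smul_eq_mul, div_mul_cancel₀ _ hne] at h1
      linarith
    have hAz : A *ᵥ z = 0 := by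
      refine dotProduct_eq_zero _ fun y => ?_
      have h1 := hW y
      rwa [hf, Matrix.mulVec_transpose, ← Matrix.dotProduct_mulVec, dotProduct_comm] at h1
    -- This corner of the box minimizes z over [0, u], with value -⟨u, z⁻⟩.
    have h1 := hfa ((fun i => if z i < 0 then u i else 0) + 0)
      (Set.add_mem_add ⟨fun i => by dsimp; split_ifs <;> simp [hu i],
        fun i => by dsimp; split_ifs <;> simp [hu i]⟩ W.zero_mem)
    rw [add_zero, hf] at h1
    rw [hf] at hfc
    have h2 := h z hAz
    have h3 : (fun i => if z i < 0 then u i else 0) ⬝ᵥ z = - ∑ i, u i * max 0 (-z i) := by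
      rw [dotProduct, ← Finset.sum_neg_distrib]
      refine Finset.sum_congr rfl fun i _ => ?_
      split_ifs with hz
      · rw [max_eq_right (by linarith)]; ring
      · rw [max_eq_left (by linarith)]; ring
    linarith

/-- A functional of the form `⟨c, z⟩ + ⟨u, z⁻⟩` that is nonnegative on elementary vectors is
nonnegative on the kernel. -/
theorem nonneg_of_elementary_nonneg (A : Matrix (Fin m) (Fin n) ℝ) (c u : Fin n → ℝ)
    (h : ∀ g, IsElementary A g → 0 ≤ c ⬝ᵥ g + ∑ i, u i * max 0 (-g i))
    (z : Fin n → ℝ) (hz : A *ᵥ z = 0) : 0 ≤ c ⬝ᵥ z + ∑ i, u i * max 0 (-z i) := by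
  induction hk : (Function.support z).ncard using Nat.strong_induction_on generalizing z with
  | _ k ih =>
    by_cases h0 : z = 0
    · simp [h0]
    · obtain ⟨g, hg, hgc, hss⟩ := exists_elementary_conformal A z h0 hz
      have h1 := h g hg
      have h2 := ih _ (hk ▸ Set.ncard_lt_ncard hss (Set.toFinite _)) (z - g)
        (by rw [Matrix.mulVec_sub, hz, hg.2.1, sub_zero]) rfl
      -- Negative parts are additive because g and z - g have the signs of z.
      have h3 : ∀ i, max 0 (-z i) = max 0 (-g i) + max 0 (-(z - g) i) := by
        intro i
        rw [Pi.sub_apply]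
        rcases Set.mem_uIcc.1 (hgc i) with ⟨p, q⟩ | ⟨p, q⟩
        · rw [max_eq_left (by linarith), max_eq_left (by linarith), max_eq_left (by linarith)]
          simp
        · rw [max_eq_right (by linarith), max_eq_right (by linarith),
            max_eq_right (by linarith)]
          ring
      simp only [h3, mul_add, Finset.sum_add_distrib]
      rw [dotProduct_sub] at h2
      linarith

theorem wallacherWeights_of_pos {x : Fin n → ℝ} {i : Fin n} (hi : 0 < x i) :
    wallacherWeights x i = ENNReal.ofReal (x i)⁻¹ :=
  (ENNReal.ofReal_inv_of_pos hi).symm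

theorem wallacherWeights_of_eq_zero {x : Fin n → ℝ} {i : Fin n} (hi : x i = 0) :
    wallacherWeights x i = ∞ := by
  simp [wallacherWeights, hi]

theorem neg_le_of_mem_ratioFeasible {A : Matrix (Fin m) (Fin n) ℝ} {x z : Fin n → ℝ}
    (hx : ∀ i, 0 ≤ x i) (hz : z ∈ ratioFeasible A (wallacherWeights x)) (i : Fin n) :
    -z i ≤ x i := by
  have h1 : wallacherWeights x i * ENNReal.ofReal (max 0 (-z i)) ≤ 1 :=
    (Finset.single_le_sum (f := fun i => wallacherWeights x i * ENNReal.ofReal (max 0 (-z i)))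
      (fun _ _ => zero_le) (Finset.mem_univ i)).trans hz.2
  by_contra hcon
  push Not at hcon
  have hpos : 0 < -z i := (hx i).trans_lt hcon
  rw [max_eq_right hpos.le] at h1
  rcases (hx i).eq_or_lt with h0 | h0
  · rw [wallacherWeights_of_eq_zero h0.symm, ENNReal.top_mul (by simpa using hpos)] at h1
    simp at h1
  · rw [wallacherWeights_of_pos h0, ← ENNReal.ofReal_mul (inv_nonneg.2 h0.le),
      ENNReal.ofReal_le_one, inv_mul_le_iff₀ h0] at h1
    linarith

theorem mem_ratioFeasible_of_sum_le {A : Matrix (Fin m) (Fin n) ℝ} {x z : Fin n → ℝ}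
    (hx : ∀ i, 0 ≤ x i) (hz : A *ᵥ z = 0) (h0 : ∀ i, x i = 0 → 0 ≤ z i)
    (h1 : ∑ i, (x i)⁻¹ * max 0 (-z i) ≤ 1) : z ∈ ratioFeasible A (wallacherWeights x) := by
  refine ⟨hz, ?_⟩
  have : ∀ i, wallacherWeights x i * ENNReal.ofReal (max 0 (-z i)) =
      ENNReal.ofReal ((x i)⁻¹ * max 0 (-z i)) := by
    intro i
    rcases (hx i).eq_or_lt with hi | hi
    · rw [max_eq_left (by linarith [h0 i hi.symm])]
      simp
    · rw [wallacherWeights_of_pos hi, ENNReal.ofReal_mul (inv_nonneg.2 hi.le)]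
  simp only [this]
  rw [← ENNReal.ofReal_sum_of_nonneg
    (fun i _ => mul_nonneg (inv_nonneg.2 (hx i)) (le_max_left _ _))]
  exact ENNReal.ofReal_le_one.2 h1

theorem cost_nonneg (N : Finset (Fin n)) (i : Fin n) : 0 ≤ cost N i := by
  unfold cost; split_ifs <;> norm_num

theorem cost_le_one (N : Finset (Fin n)) (i : Fin n) : cost N i ≤ 1 := by
  unfold cost; split_ifs <;> norm_num

theorem cost_dotProduct (N : Finset (Fin n)) (x : Fin n → ℝ) : cost N ⬝ᵥ x = ∑ i ∈ N, x i := by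
  simp [cost, dotProduct, Finset.sum_ite_mem]

theorem bddBelow_ratio {A : Matrix (Fin m) (Fin n) ℝ} (N : Finset (Fin n)) {x : Fin n → ℝ}
    (hx : ∀ i, 0 ≤ x i) :
    BddBelow ((fun z => cost N ⬝ᵥ z) '' ratioFeasible A (wallacherWeights x)) := by
  refine ⟨cost N ⬝ᵥ (-x), ?_⟩
  rintro _ ⟨z, hz, rfl⟩
  refine dotProduct_le_dotProduct_of_nonneg_left (fun i => ?_) (fun i => cost_nonneg N i)
  have := neg_le_of_mem_ratioFeasible hx hz i
  simp only [Pi.neg_apply]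
  linarith

/-- Strong duality for the minimum-ratio program with weights `1 / x`. -/
theorem exists_ratioDualFeasible {A : Matrix (Fin m) (Fin n) ℝ} {N : Finset (Fin n)}
    {x z : Fin n → ℝ} (hx : ∀ i, 0 ≤ x i)
    (hmin : ∀ z' ∈ ratioFeasible A (wallacherWeights x), cost N ⬝ᵥ z ≤ cost N ⬝ᵥ z') :
    ∃ y s, RatioDualFeasible A (cost N) (wallacherWeights x) y s (-(cost N ⬝ᵥ z)) := by
  set lam : ℝ := -(cost N ⬝ᵥ z) with hlam
  have hlam0 : 0 ≤ lam := by
    have := hmin 0 (mem_ratioFeasible_of_sum_le hx (by simp) (by simp) (by simp))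
    simp only [dotProduct_zero] at this
    linarith
  have hκ : 0 ≤ kappa A := zero_le_one.trans (one_le_kappa A)
  -- An infinite weight is replaced by the finite penalty nκ. It suffices on elementary vectors: if
  -- g_i < 0 then ⟨c, g⟩ ≥ -nκ|g_i|.
  let u : Fin n → ℝ := fun i => if x i = 0 then n * kappa A else lam * (x i)⁻¹
  have hu : ∀ i, 0 ≤ u i := by
    intro i
    simp only [u]
    split_ifs
    · positivity
    · exact mul_nonneg hlam0 (inv_nonneg.2 (hx i))
  obtain ⟨y, hy⟩ := exists_boxed_slack A (cost N) u hu (by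
    refine nonneg_of_elementary_nonneg A _ _ fun g hg => ?_
    have hterm : ∀ i, 0 ≤ u i * max 0 (-g i) := fun i => mul_nonneg (hu i) (le_max_left _ _)
    by_cases hneg : ∃ i, x i = 0 ∧ g i < 0
    · obtain ⟨i, hxi, hgi⟩ := hneg
      have h1 : n * kappa A * |g i| ≤ ∑ i, u i * max 0 (-g i) := by
        have := Finset.single_le_sum (fun i _ => hterm i) (Finset.mem_univ i)
        simpa only [u, hxi, if_true, ← abs_of_neg hgi,
          max_eq_right (abs_nonneg (g i))]
          using this
      have h2 : -(n * kappa A * |g i|) ≤ cost N ⬝ᵥ g := by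
        have : ∑ _j : Fin n, -(kappa A * |g i|) ≤ cost N ⬝ᵥ g := by
          refine Finset.sum_le_sum fun j _ => ?_
          have h3 := hg.abs_le_kappa_mul j hgi.ne
          have h4 := neg_abs_le (g j)
          nlinarith [cost_nonneg N j, cost_le_one N j, abs_nonneg (g j)]
        simp only [Finset.sum_const, Finset.card_univ, Fintype.card_fin, nsmul_eq_mul] at this
        linarith
      linarith
    · push Not at hneg
      by_cases hg0 : ∀ i, 0 ≤ g i
      · have : 0 ≤ cost N ⬝ᵥ g := dotProduct_nonneg_of_nonneg (fun i => cost_nonneg N i) hg0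
        have := Finset.sum_nonneg fun i (_ : i ∈ Finset.univ) => hterm i
        linarith
      · push Not at hg0
        obtain ⟨i, hi⟩ := hg0
        have hxi : 0 < x i := lt_of_le_of_ne (hx i) fun h0 => absurd (hneg i h0.symm) (by linarith)
        set σ : ℝ := ∑ i, (x i)⁻¹ * max 0 (-g i) with hσ
        have hσ0 : 0 < σ := by
          refine Finset.sum_pos' (fun j _ => mul_nonneg (inv_nonneg.2 (hx j)) (le_max_left _ _))
            ⟨i, Finset.mem_univ i, mul_pos (inv_pos.2 hxi) ?_⟩
          exact lt_max_of_lt_right (by linarith)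
        have hsum : ∑ i, u i * max 0 (-g i) = lam * σ := by
          rw [hσ, Finset.mul_sum]
          refine Finset.sum_congr rfl fun j _ => ?_
          simp only [u]
          split_ifs with h0
          · rw [max_eq_left (by linarith [hneg j h0])]; simp
          · ring
        have hmem : σ⁻¹ • g ∈ ratioFeasible A (wallacherWeights x) := by
          refine mem_ratioFeasible_of_sum_le hx
            (by rw [Matrix.mulVec_smul, hg.2.1, smul_zero]) (fun j hj => ?_) ?_
          · simpa using mul_nonneg (inv_nonneg.2 hσ0.le) (hneg j hj)
          · have : ∀ j, (x j)⁻¹ * max 0 (-(σ⁻¹ • g) j) = σ⁻¹ * ((x j)⁻¹ * max 0 (-g j)) := by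
              intro j
              have : max 0 (-(σ⁻¹ • g) j) = σ⁻¹ * max 0 (-g j) := by
                rw [mul_max_of_nonneg _ _ (inv_nonneg.2 hσ0.le)]
                simp
              rw [this]; ring
            simp only [this]
            rw [← Finset.mul_sum, ← hσ, inv_mul_cancel₀ hσ0.ne']
        have h1 := hmin _ hmem
        rw [dotProduct_smul, smul_eq_mul] at h1
        have h2 := mul_le_mul_of_nonneg_left h1 hσ0.le
        rw [← mul_assoc, mul_inv_cancel₀ hσ0.ne', one_mul] at h2
        rw [hsum, hlam]
        linarith)
  refine ⟨y, _, hlam0, rfl, fun i => ⟨(hy i).1, fun hw => ?_⟩⟩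
  have hxi : x i ≠ 0 := fun h0 => hw (wallacherWeights_of_eq_zero h0)
  have hpos : 0 < x i := lt_of_le_of_ne (hx i) hxi.symm
  rw [wallacherWeights_of_pos hpos, ENNReal.toReal_ofReal (inv_nonneg.2 hpos.le)]
  have := (hy i).2
  simpa only [u, if_neg hxi] using this

theorem isDualCertificate_of_ratioReply {A : Matrix (Fin m) (Fin n) ℝ} {b : Fin m → ℝ}
    {N : Finset (Fin n)} {w : Fin n → ℝ≥0∞} {r : RatioReply m n}
    (hr : IsRatioReply A (cost N) w r) (hb : 0 < b ⬝ᵥ r.y) : IsDualCertificate A b N r.y := by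
  refine ⟨fun i => ?_, hb⟩
  have h1 := (hr.dual_feasible.2.2 i).1
  rw [hr.dual_feasible.2.1, Pi.sub_apply] at h1
  linarith

theorem IsDualCertificate.not_exists {A : Matrix (Fin m) (Fin n) ℝ} {b : Fin m → ℝ}
    {N : Finset (Fin n)} {y : Fin m → ℝ} (hy : IsDualCertificate A b N y) :
    ¬ ∃ x ∈ feasible A b, ∀ i ∈ N, x i = 0 := by
  rintro ⟨x, ⟨hA, hx⟩, hN⟩
  have h1 : x ⬝ᵥ (Aᵀ *ᵥ y) ≤ x ⬝ᵥ cost N := dotProduct_le_dotProduct_of_nonneg_left hy.1 hx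
  rw [Matrix.dotProduct_transpose_mulVec, hA, dotProduct_comm y, dotProduct_comm x, cost_dotProduct,
    Finset.sum_eq_zero hN] at h1
  exact absurd hy.2 (not_lt.2 h1)

/-- Unless the minimum-ratio subroutine finds a dual certificate, it returns a circuit along which
the cost decreases by a factor `1 - 1 / n`. -/
theorem ratioReply_improves {A : Matrix (Fin m) (Fin n) ℝ} {b : Fin m → ℝ}
    {N : Finset (Fin n)} {x : Fin n → ℝ} {r : RatioReply m n} (hx : x ∈ feasible A b)
    (hc : 0 < cost N ⬝ᵥ x) (hr : IsRatioReply A (cost N) (wallacherWeights x) r)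
    (hb : b ⬝ᵥ r.y ≤ 0) :
    IsElementary A r.z ∧ cost N ⬝ᵥ x ≤ n * -(cost N ⬝ᵥ r.z) ∧ x + r.z ∈ feasible A b := by
  obtain ⟨y, s, hys⟩ := exists_ratioDualFeasible hx.2 hr.primal_optimal
  have hlam : r.lam ≤ -(cost N ⬝ᵥ r.z) := by
    have := hr.dual_optimal _ _ _ hys
    linarith
  -- ⟨c, x⟩ = ⟨x, s⟩ + ⟨b, y⟩, where ⟨b, y⟩ ≤ 0 and the weights 1/x_i bound each x_i s_i by λ.
  have h1 : cost N ⬝ᵥ x ≤ n * r.lam := by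
    have h2 : cost N ⬝ᵥ x = x ⬝ᵥ r.s + b ⬝ᵥ r.y := by
      rw [hr.dual_feasible.2.1, dotProduct_sub, Matrix.dotProduct_transpose_mulVec, hx.1,
        dotProduct_comm x, dotProduct_comm b]
      ring
    have h3 : x ⬝ᵥ r.s ≤ ∑ _i : Fin n, r.lam := by
      refine Finset.sum_le_sum fun i _ => ?_
      rcases (hx.2 i).eq_or_lt with h0 | h0
      · rw [← h0, zero_mul]; exact hr.dual_feasible.1
      · have h4 := (hr.dual_feasible.2.2 i).2 (by rw [wallacherWeights_of_pos h0]; simp)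
        rw [wallacherWeights_of_pos h0, ENNReal.toReal_ofReal (inv_nonneg.2 h0.le)] at h4
        have h5 := mul_le_mul_of_nonneg_left h4 h0.le
        rwa [mul_left_comm, mul_inv_cancel₀ h0.ne', mul_one] at h5
    simp only [Finset.sum_const, Finset.card_univ, Fintype.card_fin, nsmul_eq_mul] at h3
    linarith
  have h6 : cost N ⬝ᵥ x ≤ n * -(cost N ⬝ᵥ r.z) :=
    h1.trans (mul_le_mul_of_nonneg_left hlam (Nat.cast_nonneg n))
  refine ⟨hr.primal_basic.resolve_left fun h0 => ?_, h6, ?_, fun i => ?_⟩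
  · rw [h0] at h6; simp at h6; linarith
  · rw [Matrix.mulVec_add, hx.1, hr.primal_feasible.1, add_zero]
  · have := neg_le_of_mem_ratioFeasible hx.2 hr.primal_feasible i
    simp only [Pi.add_apply]
    linarith

/-! ### Maximal augmentation steps -/

theorem exists_maximal_step {A : Matrix (Fin m) (Fin n) ℝ} {b : Fin m → ℝ} {x z : Fin n → ℝ}
    (hx : x ∈ feasible A b) (hz : A *ᵥ z = 0) (hneg : ∃ i, z i < 0) :
    ∃ α, IsGreatest {a : ℝ | x + a • z ∈ feasible A b} α ∧ 0 ≤ α ∧ ∃ i, z i < 0 ∧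
      x i + α * z i = 0 := by
  obtain ⟨i₀, hi₀⟩ := hneg
  obtain ⟨k, hk, hmin⟩ := Finset.exists_min_image
    (Finset.univ.filter fun j => z j < 0) (fun j => x j / -z j) ⟨i₀, by simpa using hi₀⟩
  simp only [Finset.mem_filter, Finset.mem_univ, true_and] at hk hmin
  have hk' : 0 < -z k := by linarith
  have hα : 0 ≤ x k / -z k := div_nonneg (hx.2 k) hk'.le
  have hzero : x k + x k / -z k * z k = 0 := by
    have : z k ≠ 0 := hk.ne
    field_simp
    ring
  refine ⟨x k / -z k, ⟨⟨?_, fun i => ?_⟩, fun a ha => ?_⟩, hα, k, hk, hzero⟩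
  · rw [Matrix.mulVec_add, Matrix.mulVec_smul, hx.1, hz, smul_zero, add_zero]
  · simp only [Pi.add_apply, Pi.smul_apply, smul_eq_mul]
    rcases le_or_gt 0 (z i) with h | h
    · exact add_nonneg (hx.2 i) (mul_nonneg hα h)
    · have h1 := hmin i h
      rw [le_div_iff₀ (by linarith)] at h1
      linarith
  · have h1 := ha.2 k
    simp only [Pi.add_apply, Pi.smul_apply, smul_eq_mul] at h1
    rw [le_div_iff₀ hk']
    linarith

/-- A step along a circuit that decreases a coordinate of `N` decreases no coordinate by more than
`kappa A` times the cost. -/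
theorem IsElementary.sub_kappa_mul_le_step {A : Matrix (Fin m) (Fin n) ℝ} {b : Fin m → ℝ}
    {N : Finset (Fin n)} {x z : Fin n → ℝ} {α : ℝ} (hz : IsElementary A z)
    (hx : x ∈ feasible A b) (hx' : x + α • z ∈ feasible A b) (hα : 0 ≤ α)
    {i : Fin n} (hi : i ∈ N) (hzi : z i < 0) (j : Fin n) :
    x j - kappa A * (cost N ⬝ᵥ x) ≤ (x + α • z) j := by
  have h1 := hx'.2 i
  have h2 := hz.abs_le_kappa_mul j hzi.ne
  have h3 : x i ≤ cost N ⬝ᵥ x := by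
    rw [cost_dotProduct]
    exact Finset.single_le_sum (fun k _ => hx.2 k) hi
  simp only [Pi.add_apply, Pi.smul_apply, smul_eq_mul] at h1 ⊢
  rw [abs_of_neg hzi] at h2
  have h4 := neg_abs_le (z j)
  have hκ := one_le_kappa A
  -- Coordinate i stays nonnegative, so its decrease is at most x_i; the imbalance transfers this to
  -- j.
  have h5 : α * -z i ≤ cost N ⬝ᵥ x := by linarith
  have h6 : α * -z j ≤ α * (kappa A * -z i) := mul_le_mul_of_nonneg_left (by linarith) hα
  have h7 : kappa A * (α * -z i) ≤ kappa A * (cost N ⬝ᵥ x) :=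
    mul_le_mul_of_nonneg_left h5 (by linarith)
  nlinarith

theorem exists_neg_of_dotProduct_nonpos {N : Finset (Fin n)} {z : Fin n → ℝ}
    (hc : cost N ⬝ᵥ z ≤ 0) (hz : ∃ i ∈ N, z i ≠ 0) : ∃ i ∈ N, z i < 0 := by
  by_contra hcon
  push Not at hcon
  obtain ⟨i, hi, hne⟩ := hz
  rw [cost_dotProduct] at hc
  exact absurd (Finset.sum_pos' hcon ⟨i, hi, lt_of_le_of_ne (hcon i hi) hne.symm⟩) (not_lt.2 hc)

theorem aug_eq {A : Matrix (Fin m) (Fin n) ℝ} {b : Fin m → ℝ} {x z : Fin n → ℝ} {α : ℝ}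
    (h : IsGreatest {a : ℝ | x + a • z ∈ feasible A b} α) : aug A b x z = x + α • z := by
  rw [aug, h.csSup_eq]

/-! ### Progress in the rank of the large coordinates -/

/-- A conformal piece of h that is nonzero at i stays inside supp x. The support condition is
symmetric under negation, so one of ±g has nonpositive cost. -/
theorem exists_supportReply {A : Matrix (Fin m) (Fin n) ℝ} {N : Finset (Fin n)}
    {x h : Fin n → ℝ} (hA : A *ᵥ h = 0) (hs : ∀ j, x j = 0 → h j = 0) {i : Fin n} (hi : i ∈ N)
    (hne : h i ≠ 0) : ∃ z, IsSupportReply A (cost N) x N z := by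
  obtain ⟨g, hg, hgc, hle⟩ := exists_elementary_large A i n h hA hne (ncard_support_le h)
  have hgi : g i ≠ 0 := by
    intro h0
    rw [h0, abs_zero, mul_zero] at hle
    exact hne (abs_nonpos_iff.1 hle)
  have hgs : Function.support g ⊆ Function.support x := by
    intro j hj hxj
    have := hgc j
    rw [hs j hxj, Set.uIcc_self] at this
    exact hj this
  rcases le_total (cost N ⬝ᵥ g) 0 with hc | hc
  · exact ⟨g, hg, hgs, ⟨i, hi, hgi⟩, hc⟩
  · exact ⟨-g, hg.neg, by rwa [Function.support_neg], ⟨i, hi, by simpa using hgi⟩,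
      by rw [dotProduct_neg]; linarith⟩

theorem mulVec_eq_sum_smul_col (A : Matrix (Fin m) (Fin n) ℝ) (v : Fin n → ℝ) :
    A *ᵥ v = ∑ j, v j • A.col j := by
  ext k
  simp [Matrix.mulVec, dotProduct, Finset.sum_apply, mul_comm]

/-- The coordinate `j` is large at `x`, and its column is not spanned by the columns in `L`. -/
def Addable (A : Matrix (Fin m) (Fin n) ℝ) (N : Finset (Fin n)) (x : Fin n → ℝ)
    (L : Finset (Fin n)) (j : Fin n) : Prop :=
  j ∉ N ∧ A.col j ∉ Submodule.span ℝ (A.col '' (L : Set (Fin n))) ∧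
    kappa A * (n * (m + 2)) * (cost N ⬝ᵥ x) ≤ x j

/-- An exchange argument: the part p of g outside supp x is replaced by a vector q on L with Aq =
Ap. The result lies in the kernel and in supp x, and entry i is untouched since i ∈ N is not in L.
-/
theorem exists_supportReply_of_mem_span {A : Matrix (Fin m) (Fin n) ℝ} {N L : Finset (Fin n)}
    {x g : Fin n → ℝ} (hL : ∀ l ∈ L, 0 < x l) (hLN : ∀ l ∈ L, l ∉ N) (hA : A *ᵥ g = 0)
    {i : Fin n} (hi : i ∈ N) (hxi : x i ≠ 0) (hgi : g i ≠ 0)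
    (hspan : ∀ j, g j ≠ 0 → x j = 0 → A.col j ∈ Submodule.span ℝ (A.col '' (L : Set (Fin n)))) :
    ∃ z, IsSupportReply A (cost N) x N z := by
  let p : Fin n → ℝ := fun j => if x j = 0 then g j else 0
  have hp : A *ᵥ p ∈ Submodule.span ℝ (A.col '' (L : Set (Fin n))) := by
    rw [mulVec_eq_sum_smul_col]
    refine Submodule.sum_mem _ fun j _ => ?_
    by_cases hj : p j = 0
    · rw [hj, zero_smul]; exact Submodule.zero_mem _
    · refine Submodule.smul_mem _ _ (hspan j ?_ ?_)
      · intro h0; simp [p, h0] at hj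
      · by_contra h0; simp [p, h0] at hj
  obtain ⟨a, ha⟩ := Submodule.mem_span_image_finset_iff_exists_fun' ℝ |>.1 hp
  let q : Fin n → ℝ := fun l => if l ∈ L then a l else 0
  have hq : A *ᵥ q = A *ᵥ p := by
    rw [← ha, mulVec_eq_sum_smul_col]
    simp [q, ite_smul, Finset.sum_ite_mem]
  refine exists_supportReply (h := g - p + q) ?_ (fun j hj => ?_) hi ?_
  · rw [Matrix.mulVec_add, Matrix.mulVec_sub, hA, hq]; simp
  · have : j ∉ L := fun h => (hL j h).ne' hj
    simp [p, q, hj, this]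
  · have : i ∉ L := fun h => hLN i h hi
    simpa [p, q, hxi, this] using hgi

theorem exists_large_mem {N : Finset (Fin n)} {x : Fin n → ℝ} (hx : ∀ i, 0 ≤ x i)
    (hc : 0 < cost N ⬝ᵥ x) : ∃ i ∈ N, cost N ⬝ᵥ x ≤ n * x i := by
  rw [cost_dotProduct] at hc ⊢
  have hN : N.Nonempty := by
    by_contra h
    rw [Finset.not_nonempty_iff_eq_empty.1 h, Finset.sum_empty] at hc
    exact lt_irrefl _ hc
  obtain ⟨i, hi, hmax⟩ := N.exists_max_image x hN
  refine ⟨i, hi, (Finset.sum_le_card_nsmul N x _ hmax).trans ?_⟩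
  rw [nsmul_eq_mul]
  refine mul_le_mul_of_nonneg_right ?_ (hx i)
  exact_mod_cast (Finset.card_le_univ N).trans (by simp)

theorem le_cost_dotProduct {N : Finset (Fin n)} {x : Fin n → ℝ} (hx : ∀ i, 0 ≤ x i) {i : Fin n}
    (hi : i ∈ N) : x i ≤ cost N ⬝ᵥ x := by
  rw [cost_dotProduct]
  exact Finset.single_le_sum (fun k _ => hx k) hi

/-- Once the cost has dropped far enough since a point that admits no support circuit, a new
coordinate has become large. -/
theorem exists_addable {A : Matrix (Fin m) (Fin n) ℝ} {b : Fin m → ℝ} {N L : Finset (Fin n)}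
    {x x' : Fin n → ℝ} (hx : x ∈ feasible A b) (hx' : x' ∈ feasible A b)
    (hL : ∀ l ∈ L, 0 < x l) (hLN : ∀ l ∈ L, l ∉ N)
    (hno : ¬ ∃ z, IsSupportReply A (cost N) x N z) (hmn : m ≤ n) (hpos : 0 < cost N ⬝ᵥ x')
    (hsmall : 6 * (n : ℝ) ^ 4 * kappa A ^ 2 * (cost N ⬝ᵥ x') ≤ cost N ⬝ᵥ x) :
    ∃ j, Addable A N x' L j := by
  have hκ := one_le_kappa A
  have hn : (1 : ℝ) ≤ n := by
    rcases Nat.eq_zero_or_pos n with h0 | h0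
    · subst h0; simp [dotProduct] at hpos
    · exact_mod_cast h0
  have hmn' : (m : ℝ) ≤ n := by exact_mod_cast hmn
  have hnn : (n : ℝ) ≤ n ^ 4 := by
    simpa using pow_le_pow_right₀ hn (show 1 ≤ 4 by norm_num)
  set X := cost N ⬝ᵥ x
  set X' := cost N ⬝ᵥ x'
  have hXX' : 2 * n * X' ≤ X := by
    refine le_trans (mul_le_mul_of_nonneg_right ?_ hpos.le) hsmall
    have : (1 : ℝ) ≤ kappa A ^ 2 := one_le_pow₀ hκ
    nlinarith
  have hX : 0 < X := lt_of_lt_of_le (by positivity) hXX'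
  obtain ⟨i, hi, hiX⟩ := exists_large_mem hx.2 hX
  have hxi' : x' i ≤ X' := le_cost_dotProduct hx'.2 hi
  have hxi : 2 * x' i ≤ x i := by
    have h1 : (n : ℝ) * (2 * x' i) ≤ n * x i := by nlinarith
    exact le_of_mul_le_mul_left h1 (by linarith)
  have hxi0 : 0 < x i := by
    by_contra hcon
    have : x i = 0 := le_antisymm (not_lt.1 hcon) (hx.2 i)
    rw [this] at hiX; linarith
  have hd : |(x' - x) i| = x i - x' i := by
    rw [Pi.sub_apply, abs_of_nonpos (by linarith)]; ring
  obtain ⟨g, hg, hgc, hle⟩ := exists_elementary_large A i n (x' - x)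
    (by rw [Matrix.mulVec_sub, hx.1, hx'.1, sub_self])
    (by rw [← abs_pos, hd]; have := hx'.2 i; linarith) (ncard_support_le _)
  rw [hd] at hle
  -- One factor n for the largest coordinate in N, one for the share of g in the decomposition, and
  -- 2 because x_i at least halves.
  have hXg : X ≤ 2 * (n : ℝ) ^ 2 * |g i| := by nlinarith
  have hgi : g i ≠ 0 := by
    intro h0; rw [h0, abs_zero, mul_zero] at hXg; linarith
  have : ∃ j, g j ≠ 0 ∧ x j = 0 ∧
      A.col j ∉ Submodule.span ℝ (A.col '' (L : Set (Fin n))) := by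
    by_contra hcon
    push Not at hcon
    exact hno (exists_supportReply_of_mem_span hL hLN hg.2.1 hi hxi0.ne' hgi hcon)
  obtain ⟨j, hgj, hxj, hspan⟩ := this
  have h1 := hg.abs_le_kappa_mul i hgj
  have h2 : |g j| ≤ x' j := by
    have := hgc j
    rw [Pi.sub_apply, hxj, sub_zero, Set.uIcc_of_le (hx'.2 j)] at this
    rw [abs_of_nonneg this.1]; exact this.2
  have h3 : X ≤ 2 * (n : ℝ) ^ 2 * (kappa A * x' j) := by
    refine hXg.trans (mul_le_mul_of_nonneg_left ?_ (by positivity))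
    exact h1.trans (mul_le_mul_of_nonneg_left h2 (by linarith))
  -- The drop 6n⁴κ² divided by the loss 2n²κ leaves 3n²κ. This dominates κn(m + 2), as m + 2 ≤ 3n,
  -- and exceeds what a coordinate in N can hold.
  have h4 : 3 * (n : ℝ) ^ 2 * kappa A * X' ≤ x' j := by
    have h5 : (0 : ℝ) < 2 * (n : ℝ) ^ 2 * kappa A := by positivity
    refine le_of_mul_le_mul_left ?_ h5
    calc _ = 6 * (n : ℝ) ^ 4 * kappa A ^ 2 * X' := by ring
      _ ≤ X := hsmall
      _ ≤ _ := h3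
      _ = _ := by ring
  refine ⟨j, fun hjN => ?_, hspan, le_trans (mul_le_mul_of_nonneg_right ?_ hpos.le) h4⟩
  · have h5 : x' j ≤ X' := le_cost_dotProduct hx'.2 hjN
    have h6 : (1 : ℝ) ≤ n ^ 2 * kappa A := one_le_mul_of_one_le_of_one_le (one_le_pow₀ hn) hκ
    nlinarith
  · have h7 : (n : ℝ) * (m + 2) ≤ 3 * n ^ 2 := by nlinarith
    nlinarith

/-! ### The length of a phase -/

/-- A number of minimum-ratio steps after which a new coordinate is large. -/
noncomputable def phaseLength (A : Matrix (Fin m) (Fin n) ℝ) : ℕ :=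
  ⌈n * Real.log (6 * (n : ℝ) ^ 4 * kappa A ^ 2)⌉₊

theorem mul_pow_phaseLength_le_one (A : Matrix (Fin m) (Fin n) ℝ) (hn : 1 ≤ n) :
    6 * (n : ℝ) ^ 4 * kappa A ^ 2 * (1 - 1 / n) ^ phaseLength A ≤ 1 := by
  have hn' : (1 : ℝ) ≤ n := by exact_mod_cast hn
  have hM : 0 < 6 * (n : ℝ) ^ 4 * kappa A ^ 2 := by
    have := one_le_kappa A
    positivity
  have h0 : (0 : ℝ) ≤ 1 - 1 / n := sub_nonneg.2 ((div_le_one (by linarith)).2 hn')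
  have h1 : (1 - 1 / n : ℝ) ^ phaseLength A ≤
      Real.exp (-Real.log (6 * (n : ℝ) ^ 4 * kappa A ^ 2)) := by
    calc (1 - 1 / n : ℝ) ^ phaseLength A ≤ Real.exp (-(1 / n)) ^ phaseLength A := by
          refine pow_le_pow_left₀ h0 ?_ _
          have := Real.add_one_le_exp (-(1 / n : ℝ))
          linarith
      _ = Real.exp (phaseLength A * -(1 / n)) := (Real.exp_nat_mul _ _).symm
      _ ≤ _ := by
          refine Real.exp_le_exp.2 ?_
          have h2 : n * Real.log (6 * (n : ℝ) ^ 4 * kappa A ^ 2) ≤ phaseLength A := Nat.le_ceil _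
          have h3 : Real.log (6 * (n : ℝ) ^ 4 * kappa A ^ 2) ≤ phaseLength A / n := by
            rw [le_div_iff₀ (by linarith)]; linarith
          have h4 : (phaseLength A : ℝ) * -(1 / n) = -(phaseLength A / n) := by ring
          rw [h4]; linarith
  rw [Real.exp_neg, Real.exp_log hM] at h1
  calc _ ≤ 6 * (n : ℝ) ^ 4 * kappa A ^ 2 * (6 * (n : ℝ) ^ 4 * kappa A ^ 2)⁻¹ :=
        mul_le_mul_of_nonneg_left h1 hM.le
    _ = 1 := mul_inv_cancel₀ hM.ne'

/-- Leaves room for the first ratio call of a phase. -/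
theorem one_le_phaseLength (A : Matrix (Fin m) (Fin n) ℝ) (hn : 1 ≤ n) : 1 ≤ phaseLength A := by
  have hn' : (1 : ℝ) ≤ n := by exact_mod_cast hn
  refine Nat.ceil_pos.2 (mul_pos (by linarith) (Real.log_pos ?_))
  have h1 : (1 : ℝ) ≤ (n : ℝ) ^ 4 * kappa A ^ 2 :=
    one_le_mul_of_one_le_of_one_le (one_le_pow₀ hn') (one_le_pow₀ (one_le_kappa A))
  linarith

theorem phaseLength_le (A : Matrix (Fin m) (Fin n) ℝ) (hn : 1 ≤ n) :
    (phaseLength A : ℝ) ≤ 11 * (n * Real.log (n + kappa A)) := by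
  have hn' : (1 : ℝ) ≤ n := by exact_mod_cast hn
  have hκ := one_le_kappa A
  set l := Real.log (n + kappa A)
  have hl2 : Real.log 2 ≤ l := Real.log_le_log (by norm_num) (by linarith)
  have hl : 1 ≤ 2 * l := by have := Real.log_two_gt_d9; linarith
  have h6 : Real.log 6 ≤ 3 * l := by
    have : Real.log 6 ≤ Real.log (2 ^ 3) := Real.log_le_log (by norm_num) (by norm_num)
    rw [Real.log_pow] at this
    push_cast at this
    linarith
  have h1 : Real.log n ≤ l := Real.log_le_log (by linarith) (by linarith)
  have h2 : Real.log (kappa A) ≤ l := Real.log_le_log (by linarith) (by linarith)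
  have hM : Real.log (6 * (n : ℝ) ^ 4 * kappa A ^ 2) ≤ 9 * l := by
    rw [Real.log_mul (by positivity) (by positivity), Real.log_mul (by norm_num) (by positivity),
      Real.log_pow, Real.log_pow]
    push_cast
    linarith
  have hM0 : 0 ≤ Real.log (6 * (n : ℝ) ^ 4 * kappa A ^ 2) := by
    refine Real.log_nonneg ?_
    have h1 : (1 : ℝ) ≤ (n : ℝ) ^ 4 * kappa A ^ 2 :=
      one_le_mul_of_one_le_of_one_le (one_le_pow₀ hn') (one_le_pow₀ hκ)
    linarith
  -- The +1 from rounding is at most 2nl, so 9 becomes 11.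
  have h3 := (Nat.ceil_lt_add_one (mul_nonneg (by linarith : (0 : ℝ) ≤ n) hM0)).le
  rw [phaseLength]
  nlinarith

/-! ### Effect of one support or minimum-ratio step -/

theorem IsSupportReply.maxAugmentation {A : Matrix (Fin m) (Fin n) ℝ} {b : Fin m → ℝ}
    {N : Finset (Fin n)} {x z : Fin n → ℝ} (hx : x ∈ feasible A b)
    (hz : IsSupportReply A (cost N) x N z) :
    IsMaxAugmentation A b (cost N) x (aug A b x z) ∧ aug A b x z ∈ feasible A b ∧
      cost N ⬝ᵥ aug A b x z ≤ cost N ⬝ᵥ x ∧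
      (∀ j, x j - kappa A * (cost N ⬝ᵥ x) ≤ aug A b x z j) ∧
      (Function.support (aug A b x z)).ncard + 1 ≤ (Function.support x).ncard := by
  obtain ⟨hel, hsupp, hmeet, hc⟩ := hz
  obtain ⟨i, hi, hneg⟩ := exists_neg_of_dotProduct_nonpos hc hmeet
  obtain ⟨α, hα, hα0, k, hk, hzero⟩ := exists_maximal_step hx hel.2.1 ⟨i, hneg⟩
  have hxk : x k ≠ 0 := hsupp (show z k ≠ 0 from hk.ne)
  have hαpos : 0 < α := lt_of_le_of_ne hα0 fun h0 => by
    rw [← h0, zero_mul, add_zero] at hzero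
    exact hxk hzero
  rw [aug_eq hα]
  refine ⟨⟨z, hel, hc, α, hαpos, hα, rfl⟩, hα.1, ?_,
    hel.sub_kappa_mul_le_step hx hα.1 hα0 hi hneg, ?_⟩
  · rw [dotProduct_add, dotProduct_smul, smul_eq_mul]
    nlinarith
  · refine Set.ncard_lt_ncard ((Set.ssubset_iff_of_subset fun j hj => ?_).2
      ⟨k, hxk, by simpa using hzero⟩) (Set.toFinite _)
    by_contra hxj
    have h0 : x j = 0 := by simpa using hxj
    have h1 : z j = 0 := by
      by_contra hne
      exact hxj (hsupp hne)
    simp [h0, h1] at hj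

/-- The unit step is feasible, so the maximal step is at least 1 and the guaranteed decrease is
kept. -/
theorem IsRatioReply.maxAugmentation {A : Matrix (Fin m) (Fin n) ℝ} {b : Fin m → ℝ}
    {N : Finset (Fin n)} {x : Fin n → ℝ} {r : RatioReply m n} (hx : x ∈ feasible A b)
    (hc : 0 < cost N ⬝ᵥ x) (hr : IsRatioReply A (cost N) (wallacherWeights x) r)
    (hb : b ⬝ᵥ r.y ≤ 0) :
    IsMaxAugmentation A b (cost N) x (aug A b x r.z) ∧ aug A b x r.z ∈ feasible A b ∧
      cost N ⬝ᵥ aug A b x r.z ≤ (1 - 1 / n) * (cost N ⬝ᵥ x) ∧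
      ∀ j, x j - kappa A * (cost N ⬝ᵥ x) ≤ aug A b x r.z j := by
  obtain ⟨hel, hdec, hfeas⟩ := ratioReply_improves hx hc hr hb
  have hn : (0 : ℝ) < n := by
    rcases Nat.eq_zero_or_pos n with h0 | h0
    · subst h0; simp [dotProduct] at hc
    · exact_mod_cast h0
  have hcz : cost N ⬝ᵥ r.z < 0 := by
    by_contra hcon
    push Not at hcon
    nlinarith
  have hmeet : ∃ i ∈ N, r.z i ≠ 0 := by
    by_contra hcon
    push Not at hcon
    rw [cost_dotProduct, Finset.sum_eq_zero hcon] at hcz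
    exact lt_irrefl _ hcz
  obtain ⟨i, hi, hneg⟩ := exists_neg_of_dotProduct_nonpos hcz.le hmeet
  obtain ⟨α, hα, hα0, -⟩ := exists_maximal_step hx hel.2.1 ⟨i, hneg⟩
  have hα1 : 1 ≤ α := hα.2 (by simpa using hfeas)
  rw [aug_eq hα]
  refine ⟨⟨r.z, hel, hcz.le, α, by linarith, hα, rfl⟩, hα.1, ?_,
    hel.sub_kappa_mul_le_step hx hα.1 hα0 hi hneg⟩
  rw [dotProduct_add, dotProduct_smul, smul_eq_mul]
  have h1 : (cost N ⬝ᵥ x) / n ≤ -(cost N ⬝ᵥ r.z) := by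
    rw [div_le_iff₀ hn]; linarith
  have h2 : (1 - 1 / n : ℝ) * (cost N ⬝ᵥ x) = cost N ⬝ᵥ x - (cost N ⬝ᵥ x) / n := by ring
  rw [h2]
  nlinarith

/-! ### The algorithm -/

/-- The memory of the algorithm: a set of large coordinates with independent columns, and whether
support circuits are currently being eliminated. -/
structure Memory (n : ℕ) where
  large : Finset (Fin n)
  cleaning : Bool

open scoped Classical in
/-- Record a new large coordinate, if there is one, and start to eliminate support circuits. -/
noncomputable def refresh (A : Matrix (Fin m) (Fin n) ℝ) (N : Finset (Fin n)) (x : Fin n → ℝ)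
    (p : Memory n) : Memory n :=
  if h : ∃ j, Addable A N x p.large j then ⟨insert h.choose p.large, true⟩ else p

theorem not_exists_addable_refresh (A : Matrix (Fin m) (Fin n) ℝ) (N : Finset (Fin n))
    (x : Fin n → ℝ) (p : Memory n) (h : (refresh A N x p).cleaning = false) :
    ¬ ∃ j, Addable A N x (refresh A N x p).large j := by
  unfold refresh at h ⊢
  by_cases hadd : ∃ j, Addable A N x p.large j
  · rw [dif_pos hadd] at h
    exact absurd h Bool.noConfusion
  · rwa [dif_neg hadd]

open scoped Classical in
/-- Eliminate support circuits after each new large coordinate; otherwise take minimum-ratio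
steps. -/
noncomputable def feasibilityAlgorithm (A : Matrix (Fin m) (Fin n) ℝ) (N : Finset (Fin n)) :
    Algorithm n where
  Mem := Memory n
  init := ⟨∅, true⟩
  next p x :=
    if (refresh A N x p).cleaning = true ∧ ∃ z, IsSupportReply A (cost N) x N z then
      (StepKind.support, refresh A N x p)
    else (StepKind.ratio, ⟨(refresh A N x p).large, false⟩)

/-- The invariant of the run, with iterate `x`, memory `p`, numbers of calls `r` and `q`, and
output `dual`. -/
structure Invariant (A : Matrix (Fin m) (Fin n) ℝ) (b : Fin m → ℝ) (N : Finset (Fin n))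
    (x : Fin n → ℝ) (p : Memory n) (r q : ℕ) (dual : Option (Fin m → ℝ)) : Prop where
  feasible : x ∈ feasible A b
  certificate : ∀ y, dual = some y → IsDualCertificate A b N y
  indep : LinearIndepOn ℝ A.col (p.large : Set (Fin n))
  disjoint : ∀ l ∈ p.large, l ∉ N
  -- The summand (m + 1)n - q pays κX for each support call still to come. The reserve n pays for
  -- ratio calls and is restored by the drop in X. At q = 0 the factor is the threshold n(m + 2) of
  -- `Addable`.
  large : ∀ l ∈ p.large, kappa A * (n + ((m + 1) * n - q)) * (cost N ⬝ᵥ x) ≤ x l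
  supportCalls : q + (if p.cleaning = true then (Function.support x).ncard else 0) ≤
    n * (p.large.card + 1)
  -- In the second case `x₁` is the point where the current series of ratio calls began and `k`
  -- bounds its length. The decrease is required only while `dual = none`, since a call that returns
  -- a certificate does not move x.
  ratioCalls : (p.cleaning = true ∧ r ≤ phaseLength A * p.large.card) ∨
    (p.cleaning = false ∧ 1 ≤ m ∧ ∃ k x₁, k ≤ phaseLength A ∧
      r ≤ phaseLength A * p.large.card + k ∧ x₁ ∈ CircuitAug.feasible A b ∧
      (∀ l ∈ p.large, 0 < x₁ l) ∧ (¬ ∃ z, IsSupportReply A (cost N) x₁ N z) ∧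
      (dual = none → cost N ⬝ᵥ x ≤ (1 - 1 / n) ^ k * (cost N ⬝ᵥ x₁)))

/-! ### The invariant: consequences and preservation -/

theorem invariant_init {A : Matrix (Fin m) (Fin n) ℝ} {b : Fin m → ℝ} (N : Finset (Fin n))
    {x : Fin n → ℝ} (hx : x ∈ feasible A b) : Invariant A b N x ⟨∅, true⟩ 0 0 none where
  feasible := hx
  certificate := by simp
  indep := by simp
  disjoint := by simp
  large := by simp
  supportCalls := by simpa using ncard_support_le x
  ratioCalls := by simp

namespace Invariant

variable {A : Matrix (Fin m) (Fin n) ℝ} {b : Fin m → ℝ} {N : Finset (Fin n)} {x : Fin n → ℝ}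
  {p : Memory n} {r q : ℕ} {dual : Option (Fin m → ℝ)}

theorem card_large_le (h : Invariant A b N x p r q dual) : p.large.card ≤ m := by
  have := LinearIndependent.fintype_card_le_finrank h.indep
  simpa using this

theorem supportCalls_le (h : Invariant A b N x p r q dual) : q ≤ (m + 1) * n := by
  calc q ≤ n * (p.large.card + 1) := (Nat.le_add_right _ _).trans h.supportCalls
    _ ≤ n * (m + 1) := Nat.mul_le_mul_left _ (Nat.succ_le_succ h.card_large_le)
    _ = _ := Nat.mul_comm _ _

/-- There are at most m + 1 phases, and m + 1 ≤ 2m once a ratio call has occurred, because then m ≥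
1. -/
theorem ratioCalls_le (h : Invariant A b N x p r q dual) : r ≤ 2 * m * phaseLength A := by
  have h1 := Nat.mul_le_mul_left (phaseLength A) h.card_large_le
  rcases h.ratioCalls with ⟨-, h2⟩ | ⟨-, hm, k, -, hk, h2, -⟩
  · nlinarith
  · nlinarith

theorem large_pos (h : Invariant A b N x p r q dual) (hc : 0 < cost N ⬝ᵥ x) {l : Fin n}
    (hl : l ∈ p.large) : 0 < x l := by
  refine lt_of_lt_of_le (mul_pos (mul_pos ?_ ?_) hc) (h.large l hl)
  · linarith [one_le_kappa A]
  · have h1 : (q : ℝ) ≤ (m + 1) * n := by exact_mod_cast h.supportCalls_le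
    have h2 : (0 : ℝ) < n := by exact_mod_cast l.pos
    linarith

/-- Enlarging L by one adds n to the support budget, enough for any current support, and
`phaseLength A` to the ratio budget, which absorbs the open phase. -/
theorem refresh (h : Invariant A b N x p r q none) (hc : 0 < cost N ⬝ᵥ x) :
    Invariant A b N x (refresh A N x p) r q none := by
  unfold CircuitAug.refresh
  split_ifs with hadd
  · obtain ⟨hjN, hspan, hbig⟩ := hadd.choose_spec
    set j := hadd.choose
    have hj : j ∉ p.large := fun hmem => hspan (Submodule.subset_span ⟨j, hmem, rfl⟩)
    have hκ := one_le_kappa A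
    refine ⟨h.feasible, h.certificate, ?_, ?_, ?_, ?_, Or.inl ⟨rfl, ?_⟩⟩
    · rw [Finset.coe_insert]
      exact h.indep.insert hspan
    · intro l hl
      rcases Finset.mem_insert.1 hl with rfl | hl
      · exact hjN
      · exact h.disjoint l hl
    · intro l hl
      rcases Finset.mem_insert.1 hl with rfl | hl
      · refine le_trans (mul_le_mul_of_nonneg_right ?_ hc.le) hbig
        refine mul_le_mul_of_nonneg_left ?_ (by linarith)
        have : (0 : ℝ) ≤ q := Nat.cast_nonneg q
        linarith
      · exact h.large l hl
    · have h1 := (Nat.le_add_right _ _).trans h.supportCalls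
      have h2 := ncard_support_le x
      simp only [if_true, Finset.card_insert_of_notMem hj]
      nlinarith
    · simp only [Finset.card_insert_of_notMem hj]
      rcases h.ratioCalls with ⟨-, h2⟩ | ⟨-, -, k, -, hk, h2, -⟩
      · nlinarith
      · nlinarith
  · exact h

theorem support (h : Invariant A b N x p r q none) (hp : p.cleaning = true) {z : Fin n → ℝ}
    (hz : IsSupportReply A (cost N) x N z) : Invariant A b N (aug A b x z) p r (q + 1) none := by
  obtain ⟨-, hfeas, hcost, hcoord, hsupp⟩ := hz.maxAugmentation h.feasible
  have hκ := one_le_kappa A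
  refine ⟨hfeas, h.certificate, h.indep, h.disjoint, fun l hl => ?_, ?_, Or.inl ⟨hp, ?_⟩⟩
  · have h1 := h.large l hl
    have h2 := hcoord l
    have h3 := h.supportCalls
    rw [if_pos hp] at h3
    -- The call removes an element from supp x, so the support was nonempty and the budget not yet
    -- exhausted.
    have h4 : q + 1 ≤ (m + 1) * n := by
      calc q + 1 ≤ n * (p.large.card + 1) := by omega
        _ ≤ n * (m + 1) := Nat.mul_le_mul_left _ (Nat.succ_le_succ h.card_large_le)
        _ = _ := Nat.mul_comm _ _
    have h5 : (q : ℝ) + 1 ≤ (m + 1) * n := by exact_mod_cast h4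
    have hn : (0 : ℝ) ≤ n := Nat.cast_nonneg n
    push_cast
    calc kappa A * (n + ((m + 1) * n - (q + 1))) * (cost N ⬝ᵥ aug A b x z)
        ≤ kappa A * (n + ((m + 1) * n - (q + 1))) * (cost N ⬝ᵥ x) :=
          mul_le_mul_of_nonneg_left hcost (mul_nonneg (by linarith) (by linarith))
      _ = kappa A * (n + ((m + 1) * n - q)) * (cost N ⬝ᵥ x) - kappa A * (cost N ⬝ᵥ x) := by ring
      _ ≤ _ := by linarith
  · have h3 := h.supportCalls
    rw [if_pos hp] at h3 ⊢
    omega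
  · rcases h.ratioCalls with ⟨-, h2⟩ | ⟨h2, -⟩
    · exact h2
    · rw [hp] at h2; exact absurd h2 (by decide)

/-- Bookkeeping for a minimum-ratio call. -/
theorem ratio_phase (h : Invariant A b N x p r q none) (hc : 0 < cost N ⬝ᵥ x) (hmn : m ≤ n)
    (hclean : p.cleaning = true → ¬ ∃ z, IsSupportReply A (cost N) x N z)
    (hadd : p.cleaning = false → ¬ ∃ j, Addable A N x p.large j) :
    1 ≤ m ∧ ∃ k x₁, k + 1 ≤ phaseLength A ∧ r ≤ phaseLength A * p.large.card + k ∧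
      x₁ ∈ CircuitAug.feasible A b ∧ (∀ l ∈ p.large, 0 < x₁ l) ∧
      (¬ ∃ z, IsSupportReply A (cost N) x₁ N z) ∧
      cost N ⬝ᵥ x ≤ (1 - 1 / n) ^ k * (cost N ⬝ᵥ x₁) := by
  obtain ⟨i, hi, hle⟩ := exists_large_mem h.feasible.2 hc
  have hn : 1 ≤ n := i.pos
  rcases h.ratioCalls with ⟨hp, h2⟩ | ⟨hp, hm, k, x₁, hk, hr, hx₁, hL, hno, hdec⟩
  · refine ⟨?_, 0, x, one_le_phaseLength A hn, h2, h.feasible, fun l hl => h.large_pos hc hl,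
      hclean hp, by simp⟩
    -- If m = 0, the unit vector of any i ∈ N with x_i ≠ 0 is in the kernel, so a support circuit
    -- would still exist.
    by_contra hm
    have hm0 : m = 0 := by omega
    subst hm0
    have hxi : x i ≠ 0 := by
      intro h0
      rw [h0, mul_zero] at hle
      linarith
    refine hclean hp (exists_supportReply (h := Pi.single i 1) (Subsingleton.elim _ _)
      (fun j hj => ?_) hi (by simp))
    have : j ≠ i := by rintro rfl; exact hxi hj
    simp [this]
  · refine ⟨hm, k, x₁, ?_, hr, hx₁, hL, hno, hdec rfl⟩
    by_contra hcon
    -- A phase of full length would have produced an addable coordinate, which the refresh would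
    -- have recorded.
    have hkB : k = phaseLength A := by omega
    refine hadd hp (exists_addable hx₁ h.feasible hL h.disjoint hno hmn hc ?_)
    have h3 := hdec rfl
    have hκ := one_le_kappa A
    have hx₁c : 0 ≤ cost N ⬝ᵥ x₁ :=
      dotProduct_nonneg_of_nonneg (fun i => cost_nonneg N i) hx₁.2
    rw [hkB] at h3
    calc 6 * (n : ℝ) ^ 4 * kappa A ^ 2 * (cost N ⬝ᵥ x)
        ≤ 6 * (n : ℝ) ^ 4 * kappa A ^ 2 * ((1 - 1 / n) ^ phaseLength A * (cost N ⬝ᵥ x₁)) :=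
          mul_le_mul_of_nonneg_left h3 (by positivity)
      _ = 6 * (n : ℝ) ^ 4 * kappa A ^ 2 * (1 - 1 / n) ^ phaseLength A * (cost N ⬝ᵥ x₁) := by ring
      _ ≤ 1 * (cost N ⬝ᵥ x₁) :=
          mul_le_mul_of_nonneg_right (mul_pow_phaseLength_le_one A hn) hx₁c
      _ = _ := one_mul _

theorem ratio_dual (h : Invariant A b N x p r q none) (hc : 0 < cost N ⬝ᵥ x) (hmn : m ≤ n)
    (hclean : p.cleaning = true → ¬ ∃ z, IsSupportReply A (cost N) x N z)
    (hadd : p.cleaning = false → ¬ ∃ j, Addable A N x p.large j) {y : Fin m → ℝ}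
    (hy : IsDualCertificate A b N y) :
    Invariant A b N x ⟨p.large, false⟩ (r + 1) q (some y) := by
  obtain ⟨hm, k, x₁, hk, hr, hx₁, hL, hno, -⟩ := h.ratio_phase hc hmn hclean hadd
  refine ⟨h.feasible, ?_, h.indep, h.disjoint, h.large, ?_,
    Or.inr ⟨rfl, hm, k + 1, x₁, hk, Nat.succ_le_succ hr, hx₁, hL, hno, by simp⟩⟩
  · rintro _ ⟨⟩
    exact hy
  · simpa using (Nat.le_add_right _ _).trans h.supportCalls

theorem ratio_primal (h : Invariant A b N x p r q none) (hc : 0 < cost N ⬝ᵥ x) (hmn : m ≤ n)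
    (hclean : p.cleaning = true → ¬ ∃ z, IsSupportReply A (cost N) x N z)
    (hadd : p.cleaning = false → ¬ ∃ j, Addable A N x p.large j) {s : RatioReply m n}
    (hs : IsRatioReply A (cost N) (wallacherWeights x) s) (hb : b ⬝ᵥ s.y ≤ 0) :
    Invariant A b N (aug A b x s.z) ⟨p.large, false⟩ (r + 1) q none := by
  obtain ⟨hm, k, x₁, hk, hr, hx₁, hL, hno, hdec⟩ := h.ratio_phase hc hmn hclean hadd
  obtain ⟨-, hfeas, hcost, hcoord⟩ := hs.maxAugmentation h.feasible hc hb
  have hκ := one_le_kappa A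
  have hn : (1 : ℝ) ≤ n := by exact_mod_cast hm.trans hmn
  have hn0 : (0 : ℝ) ≤ 1 - 1 / n := sub_nonneg.2 ((div_le_one (by linarith)).2 hn)
  refine ⟨hfeas, h.certificate, h.indep, h.disjoint, fun l hl => ?_, ?_,
    Or.inr ⟨rfl, hm, k + 1, x₁, hk, Nat.succ_le_succ hr, hx₁, hL, hno, fun _ => ?_⟩⟩
  · have h1 := h.large l hl
    have h2 := hcoord l
    have h5 : (q : ℝ) ≤ (m + 1) * n := by exact_mod_cast h.supportCalls_le
    set d : ℝ := (m + 1) * n - q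
    have hd : 0 ≤ d := sub_nonneg.2 h5
    -- Since (n + d)(1 - 1/n) = n + d - 1 - d/n, the required bound falls by at least κX, which
    -- covers the loss in coordinate l.
    calc kappa A * (n + d) * (cost N ⬝ᵥ aug A b x s.z)
        ≤ kappa A * (n + d) * ((1 - 1 / n) * (cost N ⬝ᵥ x)) :=
          mul_le_mul_of_nonneg_left hcost (mul_nonneg (by linarith) (by linarith))
      _ = kappa A * (n + d) * (cost N ⬝ᵥ x) - kappa A * (cost N ⬝ᵥ x) * (1 + d / n) := by
          field_simp
      _ ≤ kappa A * (n + d) * (cost N ⬝ᵥ x) - kappa A * (cost N ⬝ᵥ x) * 1 := by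
          refine sub_le_sub_left (mul_le_mul_of_nonneg_left ?_
            (mul_nonneg (by linarith) hc.le)) _
          have : 0 ≤ d / n := div_nonneg hd (by linarith)
          linarith
      _ ≤ _ := by linarith
  · simpa using (Nat.le_add_right _ _).trans h.supportCalls
  · calc _ ≤ (1 - 1 / n) * (cost N ⬝ᵥ x) := hcost
      _ ≤ (1 - 1 / n) * ((1 - 1 / n) ^ k * (cost N ⬝ᵥ x₁)) := mul_le_mul_of_nonneg_left hdec hn0
      _ = _ := by ring

end Invariant

/-- The invariant for a configuration of the run. -/
def Config.Valid {A : Matrix (Fin m) (Fin n) ℝ} {N : Finset (Fin n)} (b : Fin m → ℝ)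
    (s : Config m (feasibilityAlgorithm A N)) : Prop :=
  Invariant A b N s.x s.mem s.ratioCalls s.supportCalls s.dual

/-! ### Runs: validity, termination and call counts -/

variable {A : Matrix (Fin m) (Fin n) ℝ} {b : Fin m → ℝ} {N : Finset (Fin n)}
  {R : Matrix (Fin m) (Fin n) ℝ → (Fin n → ℝ) → (Fin n → ℝ≥0∞) → RatioReply m n}
  {Q : Matrix (Fin m) (Fin n) ℝ → (Fin n → ℝ) → (Fin n → ℝ) → Finset (Fin n) →
    Option (Fin n → ℝ)}

theorem valid_step (hmn : m ≤ n) (hR : IsRatioCircuit R) (hQ : IsSupportCircuit Q)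
    {s : Config m (feasibilityAlgorithm A N)} (hs : s.Valid b) (hrunning : ¬ s.Stopped N) :
    (step R Q A b N _ s).Valid b ∧
      (step R Q A b N _ s).ratioCalls + (step R Q A b N _ s).supportCalls =
        s.ratioCalls + s.supportCalls + 1 ∧
      ((step R Q A b N _ s).dual ≠ none ∨
        IsMaxAugmentation A b (cost N) s.x (step R Q A b N _ s).x) := by
  obtain ⟨x, p, r, q, dual⟩ := s
  have hdual : dual = none := by
    by_contra hd
    exact hrunning (Or.inr hd)
  subst hdual
  have hinv : Invariant A b N x p r q none := hs
  have hc : 0 < cost N ⬝ᵥ x := by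
    by_contra hcon
    refine hrunning (Or.inl fun i hi => ?_)
    exact le_antisymm ((le_cost_dotProduct hinv.feasible.2 hi).trans (not_lt.1 hcon))
      (hinv.feasible.2 i)
  have hinv' := hinv.refresh hc
  by_cases hsup : (refresh A N x p).cleaning = true ∧ ∃ z, IsSupportReply A (cost N) x N z
  · have hnext : (feasibilityAlgorithm A N).next p x = (StepKind.support, refresh A N x p) :=
      if_pos hsup
    obtain ⟨z, hz⟩ : ∃ z, Q A (cost N) x N = some z := by
      rcases hq : Q A (cost N) x N with _ | z
      · obtain ⟨z, hz⟩ := hsup.2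
        exact absurd hz ((hQ A (cost N) x N).2 hq z)
      · exact ⟨z, rfl⟩
    have hrep := (hQ A (cost N) x N).1 z hz
    have hstep : step R Q A b N (feasibilityAlgorithm A N) ⟨x, p, r, q, none⟩ =
        ⟨aug A b x z, refresh A N x p, r, q + 1, none⟩ := by
      rw [step, if_neg hrunning]
      simp only [hnext, hz]
    rw [hstep]
    exact ⟨hinv'.support hsup.1 hrep, rfl, Or.inr (hrep.maxAugmentation hinv.feasible).1⟩
  · have hnext : (feasibilityAlgorithm A N).next p x =
        (StepKind.ratio, ⟨(refresh A N x p).large, false⟩) := if_neg hsup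
    have hclean : (refresh A N x p).cleaning = true →
        ¬ ∃ z, IsSupportReply A (cost N) x N z := fun h1 h2 => hsup ⟨h1, h2⟩
    have hadd := not_exists_addable_refresh A N x p
    have hrep := hR A (cost N) (wallacherWeights x) (bddBelow_ratio N hinv.feasible.2)
    by_cases hb : 0 < b ⬝ᵥ (R A (cost N) (wallacherWeights x)).y
    · have hstep : step R Q A b N (feasibilityAlgorithm A N) ⟨x, p, r, q, none⟩ =
          ⟨x, ⟨(refresh A N x p).large, false⟩, r + 1, q,
            some (R A (cost N) (wallacherWeights x)).y⟩ := by
        rw [step, if_neg hrunning]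
        simp only [hnext, if_pos hb]
      rw [hstep]
      exact ⟨hinv'.ratio_dual hc hmn hclean hadd (isDualCertificate_of_ratioReply hrep hb),
        Nat.add_right_comm _ _ _, Or.inl (by simp)⟩
    · have hstep : step R Q A b N (feasibilityAlgorithm A N) ⟨x, p, r, q, none⟩ =
          ⟨aug A b x (R A (cost N) (wallacherWeights x)).z, ⟨(refresh A N x p).large, false⟩,
            r + 1, q, none⟩ := by
        rw [step, if_neg hrunning]
        simp only [hnext, if_neg hb]
      rw [hstep]
      exact ⟨hinv'.ratio_primal hc hmn hclean hadd hrep (not_lt.1 hb),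
        Nat.add_right_comm _ _ _, Or.inr (hrep.maxAugmentation hinv.feasible hc (not_lt.1 hb)).1⟩

theorem run_succ {alg : Algorithm n} (x₀ : Fin n → ℝ) (t : ℕ) :
    run R Q A b N alg x₀ (t + 1) = step R Q A b N alg (run R Q A b N alg x₀ t) :=
  Function.iterate_succ_apply' _ _ _

theorem valid_run (hmn : m ≤ n) (hR : IsRatioCircuit R) (hQ : IsSupportCircuit Q)
    {x₀ : Fin n → ℝ} (hx₀ : x₀ ∈ feasible A b) (t : ℕ) :
    (run R Q A b N (feasibilityAlgorithm A N) x₀ t).Valid b := by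
  induction t with
  | zero => exact invariant_init N hx₀
  | succ t ih =>
    rw [run_succ]
    by_cases hrunning : (run R Q A b N (feasibilityAlgorithm A N) x₀ t).Stopped N
    · rwa [step, if_pos hrunning]
    · exact (valid_step hmn hR hQ ih hrunning).1

/-- Each step before stopping makes exactly one call, and the invariant bounds both call counts. -/
theorem exists_stopped (hmn : m ≤ n) (hR : IsRatioCircuit R) (hQ : IsSupportCircuit Q)
    {x₀ : Fin n → ℝ} (hx₀ : x₀ ∈ feasible A b) :
    ∃ t, (run R Q A b N (feasibilityAlgorithm A N) x₀ t).Stopped N := by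
  by_contra hcon
  push Not at hcon
  have hcalls : ∀ t, (run R Q A b N (feasibilityAlgorithm A N) x₀ t).ratioCalls +
      (run R Q A b N (feasibilityAlgorithm A N) x₀ t).supportCalls = t := by
    intro t
    induction t with
    | zero => rfl
    | succ t ih =>
      rw [run_succ, (valid_step hmn hR hQ (valid_run hmn hR hQ hx₀ t) (hcon t)).2.1, ih]
  have h := valid_run (N := N) hmn hR hQ hx₀ (2 * m * phaseLength A + (m + 1) * n + 1)
  have h1 := Invariant.ratioCalls_le h
  have h2 := Invariant.supportCalls_le h
  have h3 := hcalls (2 * m * phaseLength A + (m + 1) * n + 1)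
  omega

theorem ratioCalls_le_log {x : Fin n → ℝ} {p : Memory n} {r q : ℕ} {dual : Option (Fin m → ℝ)}
    (h : Invariant A b N x p r q dual) (hmn : m ≤ n) :
    (r : ℝ) ≤ 22 * (m * n * Real.log (n + kappa A)) := by
  have h1 : (r : ℝ) ≤ 2 * m * phaseLength A := by exact_mod_cast h.ratioCalls_le
  rcases Nat.eq_zero_or_pos m with h0 | h0
  · subst h0
    simpa using h1
  · have h2 := phaseLength_le A (h0.trans_le hmn)
    calc (r : ℝ) ≤ 2 * m * phaseLength A := h1
      _ ≤ 2 * m * (11 * (n * Real.log (n + kappa A))) :=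
          mul_le_mul_of_nonneg_left h2 (by positivity)
      _ = _ := by ring

end CircuitAug

theorem theorem3 :
    ∃ C : ℝ, 0 < C ∧
    ∃ alg : (m n : ℕ) → Matrix (Fin m) (Fin n) ℝ → (Fin m → ℝ) → Finset (Fin n) →
        CircuitAug.Algorithm n,
    ∀ (m n : ℕ) (A : Matrix (Fin m) (Fin n) ℝ) (b : Fin m → ℝ) (N : Finset (Fin n))
      (x₀ : Fin n → ℝ)
      (R : Matrix (Fin m) (Fin n) ℝ → (Fin n → ℝ) → (Fin n → ENNReal) →
        CircuitAug.RatioReply m n)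
      (Q : Matrix (Fin m) (Fin n) ℝ → (Fin n → ℝ) → (Fin n → ℝ) → Finset (Fin n) →
        Option (Fin n → ℝ)),
      A.rank = m → x₀ ∈ CircuitAug.feasible A b →
      CircuitAug.IsRatioCircuit R → CircuitAug.IsSupportCircuit Q →
      ∃ T : ℕ,
        -- the run stops after `T` steps
        (CircuitAug.run R Q A b N (alg m n A b N) x₀ T).Stopped N ∧
        -- it returns a feasible point that vanishes on `N` or a dual certificate
        (((CircuitAug.run R Q A b N (alg m n A b N) x₀ T).dual = none ∧
            (CircuitAug.run R Q A b N (alg m n A b N) x₀ T).x ∈ CircuitAug.feasible A b ∧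
            ∀ i ∈ N, (CircuitAug.run R Q A b N (alg m n A b N) x₀ T).x i = 0) ∨
          (∃ y, (CircuitAug.run R Q A b N (alg m n A b N) x₀ T).dual = some y ∧
            CircuitAug.IsDualCertificate A b N y ∧
            ¬ ∃ x ∈ CircuitAug.feasible A b, ∀ i ∈ N, x i = 0)) ∧
        -- each step is a maximal circuit augmentation, except a last one that returns a dual
        (∀ t < T,
          (CircuitAug.run R Q A b N (alg m n A b N) x₀ (t + 1)).dual ≠ none ∨
          CircuitAug.IsMaxAugmentation A b (CircuitAug.cost N)
            (CircuitAug.run R Q A b N (alg m n A b N) x₀ t).x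
            (CircuitAug.run R Q A b N (alg m n A b N) x₀ (t + 1)).x) ∧
        -- numbers of calls to the two subroutines
        ((CircuitAug.run R Q A b N (alg m n A b N) x₀ T).ratioCalls : ℝ) ≤
          C * (m * n * Real.log (n + CircuitAug.kappa A)) ∧
        (CircuitAug.run R Q A b N (alg m n A b N) x₀ T).supportCalls ≤ (m + 1) * n := by
  classical
  refine ⟨22, by norm_num, fun m n A b N => CircuitAug.feasibilityAlgorithm A N, ?_⟩
  intro m n A b N x₀ R Q hrank hx₀ hR hQ
  have hmn : m ≤ n := by
    have := A.rank_le_width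
    omega
  have hex := CircuitAug.exists_stopped (N := N) hmn hR hQ hx₀
  have hvalid := CircuitAug.valid_run (N := N) hmn hR hQ hx₀ (Nat.find hex)
  refine ⟨Nat.find hex, Nat.find_spec hex, ?_, fun t ht => ?_,
    CircuitAug.ratioCalls_le_log hvalid hmn, CircuitAug.Invariant.supportCalls_le hvalid⟩
  · rcases hd : (CircuitAug.run R Q A b N (CircuitAug.feasibilityAlgorithm A N) x₀
      (Nat.find hex)).dual with _ | y
    · exact Or.inl ⟨rfl, CircuitAug.Invariant.feasible hvalid,
        (Nat.find_spec hex).resolve_right fun h => h hd⟩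
    · have hy := CircuitAug.Invariant.certificate hvalid y hd
      exact Or.inr ⟨y, rfl, hy, hy.not_exists⟩
  · rw [CircuitAug.run_succ]
    exact (CircuitAug.valid_step hmn hR hQ (CircuitAug.valid_run hmn hR hQ hx₀ t)
      (Nat.find_min hex ht)).2.2
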